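/- Let $n\ge 1$. On $\mathbb R\times\mathbb R^n$ use coordinates $x=(x^0,\bar x)$, and $y=(y^0,\bar y)$ for tangent vectors; indices $A,B,C$ run from $0$ to $n$, indices $i,m$ from $1$ to $n$, and repeated indices are summed. Put $\alpha=|\bar y|$, $z=y^0/|\bar y|$, $\rho=|\bar x|$ and $\bar x\cdot\bar y=x^my^m$. For a function $\phi(z,\rho)$ let $F=\alpha\sqrt{\phi(z,\rho)}$; more generally, allowing indefinite signature, let $L=\alpha^2\phi(z,\rho)$, so that $L=F^2$ where $\phi\ge 0$. Put $$\Omega=2\phi-z\phi_z,\qquad \Lambda=2\phi\phi_{zz}-\phi_z^2,$$ $$U=\frac{2\phi\phi_{z\rho}-\phi_z\phi_\rho}{2\rho\Lambda},\qquad V=\frac{\phi_\rho\phi_{zz}-\phi_z\phi_{z\rho}}{2\rho\Lambda},\qquad W=\frac{\phi_\rho}{2\rho\Omega},$$ $$\Psi=U_z+(n+2)V+(n-1)W .$$ Let $D\subseteq\mathbb R\times(0,\infty)$ be any open set of pairs $(z,\rho)$ on which $\phi$ is $C^\infty$ and $\Omega\neq0$, $\Lambda\ne 0$. All assertions below about $(x,y)$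 are for all $(x,y)$ with $\bar y\ne0$ and $(z,\rho)\in D$. With $g_{AB}=\frac12[L]_{y^Ay^B}$ and spray coefficients $G^C=\frac14g^{CA}\left([L]_{y^Ax^B}y^B-[L]_{x^A}\right)$, put $$\Pi=\frac{\partial G^C}{\partial y^C},\qquad \chi_A=\tfrac12\left[\Pi_{x^By^A}y^B-\Pi_{x^A}-2\Pi_{y^Ay^B}G^B\right],$$ $$K^C_B=2[G^C]_{x^B}-[G^C]_{x^Ay^B}y^A+2G^A[G^C]_{y^Ay^B}-[G^C]_{y^A}[G^A]_{y^B},\qquad \mathrm{Ric}=K^A_A.$$ Akbar-Zadeh's Ricci tensor is $\mathrm{Ric}_{AB}=\frac12[\mathrm{Ric}]_{y^Ay^B}$. Li and Shen's Ricci tensor is $\widetilde{\mathrm{Ric}}_{AB}=\frac12\left(R_A{}^C{}_{CB}+R_B{}^C{}_{CA}\right)$, where $R_B{}^A{}_{CD}=\frac13\left([K^A_C]_{y^Dy^B}-[K^A_D]_{y^Cy^B}\right)$ is Berwald's Riemann curvature tensor. **(1)** $\Pi=\Psi\,(\bar x\cdot\bar y)$, and $$\chi_0=\left[\tfrac1{2\rho}\Psi_{z\rho}-U\Psi_{zz}-W\Psi_z\right]\frac{(\bar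 x\cdot\bar y)^2}{\alpha}+\tfrac12(2\rho^2W+1)\Psi_z\,\alpha,$$ $$\chi_i=\left[zU\Psi_{zz}-\tfrac z{2\rho}\Psi_{z\rho}+(U+2zW)\Psi_z\right]\frac{(\bar x\cdot\bar y)^2}{\alpha^2}y^i-\tfrac z2(2\rho^2W+1)\Psi_z\,y^i-(U+zW)\Psi_z(\bar x\cdot\bar y)\,x^i .$$ **(2)** If $\Psi_z=0$ on $D$, then $\chi_A=0$ for all $A$. **(3)** If $\phi$ is one of the functions listed below, then $\Psi_z=0$ on $D$ and the metric is strongly Ricci-flat: $\mathrm{Ric}=0$ and $\widetilde{\mathrm{Ric}}_{AB}=\mathrm{Ric}_{AB}=0$ for all $A,B$. Everywhere $A,B>0$ and $C\in\mathbb R$ are constants unless said otherwise, and arbitrary functions $f,g$ of $\rho$ are $C^\infty$ on the set of values of $\rho$ that occur in $D$. *Riemannian ($\sigma=1$) and Lorentzian ($\sigma=-1$) metrics.* - $n\ge3$: $\ Az^2+\sigma B\ $ and $\ A\left(\frac{C-\rho^{2-n}}{C+\rho^{2-n}}\right)^2z^2+\sigma B|\rho^{2-n}+C|^{\frac4{n-2}}$.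 - $n=2$: $\ Az^2+\sigma B|\rho|^C$ with $C\ne-2$, and $\ (A_1+A_2\ln|\rho|)^2z^2+\sigma B\rho^{-2}$ with $A_1,A_2\in\mathbb R$. - $n=1$: $\ Az^2+\sigma e^{g(\rho)}\ $ and $\ e^{f(\rho)}\left(z^2+\sigma B[f'(\rho)]^2\right)$. *$m$-th root metrics*, $m>2$ an integer, with $\sigma=1$, or with $\sigma=-1$ (Lorentzian) if $m\equiv2\pmod 4$. Here, for $a<0$, $a^{2/m}$ means $|a|^{2/m}$ if $m$ is odd, and $-|a|^{2/m}$ (the real root of odd order $m/2$) if $m\equiv 2\pmod 4$. - $n\ge3$: $\ (Az^m+\sigma B)^{2/m}\ $ and $\ (Az^m+\sigma B\rho^{-2m})^{2/m}$. - $n=2$: $\ (Az^m+\sigma B|\rho|^C)^{2/m}$. - $n=1$: $\ (Az^m+\sigma B)^{2/m}\ $ and $\ (Az^m+\sigma B|\rho^2+C|^{-m})^{2/m}$. *Randers metrics*, $0<|\varepsilon|<1$. - $n\ge3$: $\ (\sqrt{Az^2+B}+\varepsilon\sqrt A\,z)^2\ $ and $\ (\sqrt{Az^2+B\rho^{-4}}+\varepsilon\sqrt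 A\,z)^2$. - $n=2$: $\ (\sqrt{Az^2+B|\rho|^C}+\varepsilon\sqrt A\,z)^2$. - $n=1$: $\ (\sqrt{Az^2+e^{g(\rho)}}+\varepsilon\sqrt A\,z)^2$. -/

import Mathlib

open scoped ContDiff

noncomputable section

namespace WarpedFinsler

/-! ### Functions of the two variables `(z, ρ)` -/

/-- Partial derivative in the first variable `z`. -/
def dz (f : ℝ → ℝ → ℝ) : ℝ → ℝ → ℝ := fun z ρ => deriv (fun t => f t ρ) z

/-- Partial derivative in the second variable `ρ`. -/
def dr (f : ℝ → ℝ → ℝ) : ℝ → ℝ → ℝ := fun z ρ => deriv (fun t => f z t) ρ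

/-- `Ω = 2 φ - z φ_z`. -/
def Om (φ : ℝ → ℝ → ℝ) : ℝ → ℝ → ℝ := fun z ρ => 2 * φ z ρ - z * dz φ z ρ

/-- `Λ = 2 φ φ_zz - φ_z ^ 2`. -/
def Lam (φ : ℝ → ℝ → ℝ) : ℝ → ℝ → ℝ := fun z ρ =>
  2 * φ z ρ * dz (dz φ) z ρ - (dz φ z ρ) ^ 2

/-- `U = (2 φ φ_zρ - φ_z φ_ρ) / (2 ρ Λ)`. -/
def U (φ : ℝ → ℝ → ℝ) : ℝ → ℝ → ℝ := fun z ρ =>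
  1 / (2 * ρ * Lam φ z ρ) * (2 * φ z ρ * dr (dz φ) z ρ - dz φ z ρ * dr φ z ρ)

/-- `V = (φ_ρ φ_zz - φ_z φ_zρ) / (2 ρ Λ)`. -/
def V (φ : ℝ → ℝ → ℝ) : ℝ → ℝ → ℝ := fun z ρ =>
  1 / (2 * ρ * Lam φ z ρ) * (dr φ z ρ * dz (dz φ) z ρ - dz φ z ρ * dr (dz φ) z ρ)

/-- `W = φ_ρ / (2 ρ Ω)`. -/
def W (φ : ℝ → ℝ → ℝ) : ℝ → ℝ → ℝ := fun z ρ =>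
  1 / (2 * ρ * Om φ z ρ) * dr φ z ρ

/-- `Ψ = U_z + (n + 2) V + (n - 1) W`. -/
def Psi (n : ℕ) (φ : ℝ → ℝ → ℝ) : ℝ → ℝ → ℝ := fun z ρ =>
  dz (U φ) z ρ + ((n : ℝ) + 2) * V φ z ρ + ((n : ℝ) - 1) * W φ z ρ

/-- An open set of pairs `(z, ρ)`, `ρ > 0`, on which `φ` is smooth and the metric it
defines is non-degenerate. -/
structure IsRegularDomain (φ : ℝ → ℝ → ℝ) (D : Set (ℝ × ℝ)) : Prop where
  isOpen : IsOpen D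
  pos : ∀ p ∈ D, 0 < p.2
  smooth : ContDiffOn ℝ ∞ (Function.uncurry φ) D
  om_ne : ∀ p ∈ D, Om φ p.1 p.2 ≠ 0
  lam_ne : ∀ p ∈ D, Lam φ p.1 p.2 ≠ 0

/-! ### Coordinates on the tangent bundle of `ℝ × ℝⁿ`

A point of `ℝ × ℝⁿ`, and a tangent vector, is a function on `Fin (n + 1)`; the index `0` is
the coordinate in `ℝ`, the indices `i.succ` are the coordinates in `ℝⁿ`. -/

/-- Coordinate vectors `(v⁰, v¹, …, vⁿ)`. -/
abbrev Coord (n : ℕ) := Fin (n + 1) → ℝ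

variable {n : ℕ}

/-- Euclidean norm of the spatial part `(v¹, …, vⁿ)`. -/
def spNorm (v : Coord n) : ℝ := Real.sqrt (∑ i : Fin n, v i.succ ^ 2)

/-- `x^m y^m`, the Euclidean inner product of the spatial parts. -/
def spDot (x y : Coord n) : ℝ := ∑ i : Fin n, x i.succ * y i.succ

/-- `z = y⁰ / α` with `α = |ȳ|`. -/
def zOf (y : Coord n) : ℝ := y 0 / spNorm y

/-- The pairs `(x, y)` with `ȳ ≠ 0` and `(z, ρ) ∈ D`, where `z = y⁰ / |ȳ|`, `ρ = |x̄|`. -/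
def Over (D : Set (ℝ × ℝ)) (x y : Coord n) : Prop :=
  spNorm y ≠ 0 ∧ (zOf y, spNorm x) ∈ D

/-- The partial derivative `∂f/∂x^A` of a function of `(x, y)`. -/
def dx (A : Fin (n + 1)) (f : Coord n → Coord n → ℝ) : Coord n → Coord n → ℝ :=
  fun x y => fderiv ℝ (fun x' => f x' y) x (Pi.single A 1)

/-- The partial derivative `∂f/∂y^A` of a function of `(x, y)`. -/
def dy (A : Fin (n + 1)) (f : Coord n → Coord n → ℝ) : Coord n → Coord n → ℝ :=
  fun x y => fderiv ℝ (fun y' => f x y') y (Pi.single A 1)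

/-! ### The metric -/

/-- `F = α √φ(z, ρ)`. -/
def finslerF (φ : ℝ → ℝ → ℝ) (x y : Coord n) : ℝ :=
  spNorm y * Real.sqrt (φ (zOf y) (spNorm x))

/-- `L = α² φ(z, ρ)`; this is `F²` where `φ ≥ 0`, and the (possibly indefinite) metric function
in general. -/
def metricL (φ : ℝ → ℝ → ℝ) (x y : Coord n) : ℝ :=
  spNorm y ^ 2 * φ (zOf y) (spNorm x)

theorem finslerF_sq (φ : ℝ → ℝ → ℝ) (x y : Coord n) (h : 0 ≤ φ (zOf y) (spNorm x)) :
    finslerF φ x y ^ 2 = metricL φ x y := by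
  simp only [finslerF, metricL, mul_pow, Real.sq_sqrt h]

/-- The fundamental tensor `g_AB = ½ [L]_{y^A y^B}`. -/
def fundTensor (L : Coord n → Coord n → ℝ) (x y : Coord n) :
    Matrix (Fin (n + 1)) (Fin (n + 1)) ℝ :=
  Matrix.of fun A B => 1 / 2 * dy B (dy A L) x y

/-- The spray coefficients `G^C = ¼ g^{CA} ([L]_{y^A x^B} y^B - [L]_{x^A})`. -/
def spray (L : Coord n → Coord n → ℝ) (C : Fin (n + 1)) (x y : Coord n) : ℝ :=
  1 / 4 * ∑ A, (fundTensor L x y)⁻¹ C A *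
    ((∑ B, dx B (dy A L) x y * y B) - dx A L x y)

/-! ### Curvatures of a spray `G` -/

/-- `Π = ∂G^C / ∂y^C`. -/
def meanBerwald (G : Fin (n + 1) → Coord n → Coord n → ℝ) (x y : Coord n) : ℝ :=
  ∑ C, dy C (G C) x y

/-- The flag curvature tensor (Berwald's formula)
`K^C_B = 2 [G^C]_{x^B} - [G^C]_{x^A y^B} y^A + 2 G^A [G^C]_{y^A y^B} - [G^C]_{y^A} [G^A]_{y^B}`. -/
def flagCurv (G : Fin (n + 1) → Coord n → Coord n → ℝ) (C B : Fin (n + 1)) (x y : Coord n) : ℝ :=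
  2 * dx B (G C) x y - (∑ A, dy B (dx A (G C)) x y * y A)
    + 2 * (∑ A, G A x y * dy B (dy A (G C)) x y)
    - ∑ A, dy A (G C) x y * dy B (G A) x y

/-- The Ricci curvature `Ric = K^A_A`. -/
def ricci (G : Fin (n + 1) → Coord n → Coord n → ℝ) (x y : Coord n) : ℝ :=
  ∑ A, flagCurv G A A x y

/-- Akbar-Zadeh's Ricci tensor `Ric_AB = ½ [Ric]_{y^A y^B}`. -/
def ricciAZ (G : Fin (n + 1) → Coord n → Coord n → ℝ) (A B : Fin (n + 1)) (x y : Coord n) : ℝ :=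
  1 / 2 * dy B (dy A (ricci G)) x y

/-- Berwald's Riemann curvature tensor
`R_B^A_CD = ⅓ ([K^A_C]_{y^D y^B} - [K^A_D]_{y^C y^B})`. -/
def riemannBerwald (G : Fin (n + 1) → Coord n → Coord n → ℝ) (B A C D : Fin (n + 1))
    (x y : Coord n) : ℝ :=
  1 / 3 * (dy B (dy D (flagCurv G A C)) x y - dy B (dy C (flagCurv G A D)) x y)

/-- Li and Shen's Ricci tensor `½ (R_A^C_CB + R_B^C_CA)`. -/
def ricciLS (G : Fin (n + 1) → Coord n → Coord n → ℝ) (A B : Fin (n + 1)) (x y : Coord n) : ℝ :=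
  1 / 2 * ((∑ C, riemannBerwald G A C C B x y) + ∑ C, riemannBerwald G B C C A x y)

/-- The χ-curvature `χ_A = ½ (Π_{x^B y^A} y^B - Π_{x^A} - 2 Π_{y^A y^B} G^B)`. -/
def chiCurv (G : Fin (n + 1) → Coord n → Coord n → ℝ) (A : Fin (n + 1)) (x y : Coord n) : ℝ :=
  1 / 2 * ((∑ B, dy A (dx B (meanBerwald G)) x y * y B) - dx A (meanBerwald G) x y
    - 2 * ∑ B, dy B (dy A (meanBerwald G)) x y * G B x y)

/-! ### The constructed solutions -/

/-- The real number `a ^ (2 / m)`, with real odd roots for negative `a`: it is `(ᵐ√a)²` for odd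
`m`, and the root of order `m / 2` of `a` if `m / 2` is an odd integer. -/
def powTwoDiv (m : ℕ) (a : ℝ) : ℝ :=
  if 0 ≤ a then a ^ (2 / (m : ℝ))
  else if Odd m then (-a) ^ (2 / (m : ℝ)) else -(-a) ^ (2 / (m : ℝ))

/-- The sign `σ` in front of the purely spatial term of a Riemannian-type solution:
`1` for the positive definite metric, `-1` for the Lorentzian one. -/
def IsSign (σ : ℝ) : Prop := σ = 1 ∨ σ = -1

/-- The sign `σ` for `m`-th root metrics, `m > 2`: `σ = 1` for all `m`, and `σ = -1`
(the Lorentzian metrics) for `m ≡ 2 (mod 4)`. -/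
def IsRootSign (m : ℕ) (σ : ℝ) : Prop := 2 < m ∧ (σ = 1 ∨ (σ = -1 ∧ m % 4 = 2))

/-- The functions `φ(z, ρ)` constructed in spatial dimension `n`; arbitrary functions of `ρ` occur
for `n = 1` only, and are smooth on the set `I` of values of `ρ`. -/
inductive IsConstructed (n : ℕ) (I : Set ℝ) : (ℝ → ℝ → ℝ) → Prop
  | riemConst (A B σ : ℝ) (hn : 3 ≤ n) (hA : 0 < A) (hB : 0 < B) (hσ : IsSign σ) :
      IsConstructed n I (fun z _ => A * z ^ 2 + σ * B)
  | riemSchw (A B C σ : ℝ) (hn : 3 ≤ n) (hA : 0 < A) (hB : 0 < B) (hσ : IsSign σ) :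
      IsConstructed n I (fun z ρ =>
        A * ((C - ρ ^ (2 - (n : ℤ))) / (C + ρ ^ (2 - (n : ℤ)))) ^ 2 * z ^ 2
          + σ * (B * |ρ ^ (2 - (n : ℤ)) + C| ^ (4 / ((n : ℝ) - 2))))
  | riemTwoPow (A B C σ : ℝ) (hn : n = 2) (hA : 0 < A) (hB : 0 < B) (hC : C ≠ -2)
      (hσ : IsSign σ) :
      IsConstructed n I (fun z ρ => A * z ^ 2 + σ * (B * |ρ| ^ C))
  | riemTwoLog (A₁ A₂ B σ : ℝ) (hn : n = 2) (hB : 0 < B) (hσ : IsSign σ) :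
      IsConstructed n I (fun z ρ =>
        (A₁ + A₂ * Real.log |ρ|) ^ 2 * z ^ 2 + σ * (B * ρ ^ (-2 : ℤ)))
  | riemOneExp (A σ : ℝ) (g : ℝ → ℝ) (hn : n = 1) (hA : 0 < A) (hg : ContDiffOn ℝ ∞ g I)
      (hσ : IsSign σ) :
      IsConstructed n I (fun z ρ => A * z ^ 2 + σ * Real.exp (g ρ))
  | riemOneDeriv (B σ : ℝ) (f : ℝ → ℝ) (hn : n = 1) (hB : 0 < B) (hf : ContDiffOn ℝ ∞ f I)
      (hσ : IsSign σ) :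
      IsConstructed n I (fun z ρ => Real.exp (f ρ) * (z ^ 2 + σ * (B * (deriv f ρ) ^ 2)))
  | rootConst (m : ℕ) (A B σ : ℝ) (hn : 3 ≤ n) (hA : 0 < A) (hB : 0 < B) (hσ : IsRootSign m σ) :
      IsConstructed n I (fun z _ => powTwoDiv m (A * z ^ m + σ * B))
  | rootPow (m : ℕ) (A B σ : ℝ) (hn : 3 ≤ n) (hA : 0 < A) (hB : 0 < B) (hσ : IsRootSign m σ) :
      IsConstructed n I (fun z ρ =>
        powTwoDiv m (A * z ^ m + σ * (B * ρ ^ (-2 * (m : ℤ)))))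
  | rootTwo (m : ℕ) (A B C σ : ℝ) (hn : n = 2) (hA : 0 < A) (hB : 0 < B)
      (hσ : IsRootSign m σ) :
      IsConstructed n I (fun z ρ => powTwoDiv m (A * z ^ m + σ * (B * |ρ| ^ C)))
  | rootOneConst (m : ℕ) (A B σ : ℝ) (hn : n = 1) (hA : 0 < A) (hB : 0 < B)
      (hσ : IsRootSign m σ) :
      IsConstructed n I (fun z _ => powTwoDiv m (A * z ^ m + σ * B))
  | rootOnePow (m : ℕ) (A B C σ : ℝ) (hn : n = 1) (hA : 0 < A) (hB : 0 < B)
      (hσ : IsRootSign m σ) :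
      IsConstructed n I (fun z ρ =>
        powTwoDiv m (A * z ^ m + σ * (B * |ρ ^ 2 + C| ^ (-(m : ℤ)))))
  | randersConst (A B ε : ℝ) (hn : 3 ≤ n) (hA : 0 < A) (hB : 0 < B) (hε : 0 < |ε|)
      (hε' : |ε| < 1) :
      IsConstructed n I (fun z _ =>
        (Real.sqrt (A * z ^ 2 + B) + ε * Real.sqrt A * z) ^ 2)
  | randersPow (A B ε : ℝ) (hn : 3 ≤ n) (hA : 0 < A) (hB : 0 < B) (hε : 0 < |ε|)
      (hε' : |ε| < 1) :
      IsConstructed n I (fun z ρ =>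
        (Real.sqrt (A * z ^ 2 + B * ρ ^ (-4 : ℤ)) + ε * Real.sqrt A * z) ^ 2)
  | randersTwo (A B C ε : ℝ) (hn : n = 2) (hA : 0 < A) (hB : 0 < B) (hε : 0 < |ε|)
      (hε' : |ε| < 1) :
      IsConstructed n I (fun z ρ =>
        (Real.sqrt (A * z ^ 2 + B * |ρ| ^ C) + ε * Real.sqrt A * z) ^ 2)
  | randersOne (A ε : ℝ) (g : ℝ → ℝ) (hn : n = 1) (hA : 0 < A) (hg : ContDiffOn ℝ ∞ g I)
      (hε : 0 < |ε|) (hε' : |ε| < 1) :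
      IsConstructed n I (fun z ρ =>
        (Real.sqrt (A * z ^ 2 + Real.exp (g ρ)) + ε * Real.sqrt A * z) ^ 2)

end WarpedFinsler

end

open WarpedFinsler

/-!
The argument works with derivatives in arbitrary directions `v` instead of coordinate directions, so
that the coordinates `0` and `i` need no separate treatment.

*The spray.* On the plane of `(1, 0)` and `(0, ȳ)` the fundamental tensor is a `2 × 2` block of
determinant `Λ / 4`, on the complement it is `Ω / 2` times the Euclidean metric; hence it is
invertible. With `s = x^m y^m`, the vector `G⁰ = s α (U + z V)`, `Gⁱ = s (V + W) yⁱ - α² W xⁱ` solves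
the linear system that defines the spray (`IsRegularDomain.spray_eq`), because of three identities
between `U`, `V`, `W` and the derivatives of `φ`. Its divergence along the fibres is `Ψ s`
(`IsRegularDomain.meanBerwald_eq`), and the χ-curvature follows from the chain rule; the derivative
of `z` along the spray is `s U`. All terms of the χ-curvature carry a derivative of `Ψ_z` or `Ψ_z`
itself, so it vanishes with `Ψ_z`.

*From `Ric = 0` to both tensors.* Every spray satisfies `2 [K^C_B]_{y^C} + [Ric]_{y^B} = -6 χ_B`
(`sum_dy_flagCurv`). If `Ric` and `χ` vanish on an open set, then so does the divergence of `K`, and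
with it the contractions of Berwald's tensor that make up the tensor of Li and Shen.

*The solutions.* All of them have a spray that is quadratic in `y`:
`G⁰ = p s y⁰`, `Gⁱ = q s yⁱ - (r (y⁰)² + q α² / 2) xⁱ` with functions `p`, `q`, `r` of `ρ`. Then
`Ψ = p + n q`, so `Ψ_z = 0`, and `Ric` is a combination of `(y⁰)²`, `α²` and `s²` whose
coefficients are ordinary differential expressions in `p`, `q`, `r`
(`HasQuadraticSpray.ricci_eq`). The Randers and root metrics have the form `H(z, h(ρ))` with `H`
homogeneous of degree two, which by Euler's theorem is the equation `φ_ρ = ρ q Ω`; they share the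
spray of the metric `z² + h²`, with `p = r = 0` (`hasQuadraticSpray_of_dr_eq`). For `a(ρ) z² + b(ρ)`
one has `a' = 2 ρ p a`, `b' = 2 ρ q b`, `r = p a / (2 b)` (`stronglyRicciFlat_quadratic`). What
remains are the differential equations for `p` and `q` in each case, and the remark that the spheres
on which the radicand or a coefficient is unbounded do not meet `D`.
-/

noncomputable section

namespace WarpedFinsler

/-! ### Partial derivatives of functions of two vector variables -/

section Calculus

variable {E : Type*} [NormedAddCommGroup E] [NormedSpace ℝ E]

/-- `f` is differentiable at `(x, y)` as a function of the pair, and `v` is its derivative in the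
direction `(a, b)`. -/
def HasPD (f : E → E → ℝ) (x y a b : E) (v : ℝ) : Prop :=
  DifferentiableAt ℝ (Function.uncurry f) (x, y) ∧
    fderiv ℝ (Function.uncurry f) (x, y) (a, b) = v

/-- Smoothness in the pair `(x, y)` on a set of pairs. -/
def Smooth (S : Set (E × E)) (f : E → E → ℝ) : Prop :=
  ContDiffOn ℝ ∞ (Function.uncurry f) S

/-- Partial derivative in the first variable, in the direction `a`. -/
def pdFst (a : E) (f : E → E → ℝ) : E → E → ℝ := fun x y => fderiv ℝ (fun x' => f x' y) x a

/-- Partial derivative in the second variable, in the direction `b`. -/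
def pdSnd (b : E) (f : E → E → ℝ) : E → E → ℝ := fun x y => fderiv ℝ (fun y' => f x y') y b

variable {f g : E → E → ℝ} {x y a b : E} {v w : ℝ} {S : Set (E × E)}

theorem HasPD.val (h : HasPD f x y a b v) (e : v = w) : HasPD f x y a b w := e ▸ h

theorem HasPD.add (hf : HasPD f x y a b v) (hg : HasPD g x y a b w) :
    HasPD (fun x y => f x y + g x y) x y a b (v + w) := by
  have h := hf.1.hasFDerivAt.add hg.1.hasFDerivAt
  refine ⟨h.differentiableAt, ?_⟩
  rw [← hf.2, ← hg.2]
  exact congrArg (fun l => l (a, b)) h.fderiv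

theorem HasPD.sub (hf : HasPD f x y a b v) (hg : HasPD g x y a b w) :
    HasPD (fun x y => f x y - g x y) x y a b (v - w) := by
  have h := hf.1.hasFDerivAt.sub hg.1.hasFDerivAt
  refine ⟨h.differentiableAt, ?_⟩
  rw [← hf.2, ← hg.2]
  exact congrArg (fun l => l (a, b)) h.fderiv

theorem HasPD.mul (hf : HasPD f x y a b v) (hg : HasPD g x y a b w) :
    HasPD (fun x y => f x y * g x y) x y a b (v * g x y + f x y * w) := by
  have h := hf.1.hasFDerivAt.mul hg.1.hasFDerivAt
  refine ⟨h.differentiableAt, ?_⟩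
  rw [← hf.2, ← hg.2]
  refine (congrArg (fun l => l (a, b)) h.fderiv).trans ?_
  simp [Function.uncurry]
  ring

theorem HasPD.sq (hf : HasPD f x y a b v) :
    HasPD (fun x y => f x y ^ 2) x y a b (2 * f x y * v) := by
  simp only [pow_two]
  exact (hf.mul hf).val (by ring)

theorem HasPD.const (c : ℝ) : HasPD (fun _ _ => c) x y a b 0 := by
  have h := hasFDerivAt_const (𝕜 := ℝ) c ((x, y) : E × E)
  exact ⟨h.differentiableAt, congrArg (fun l => l (a, b)) h.fderiv⟩

theorem HasPD.const_mul (c : ℝ) (hf : HasPD f x y a b v) :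
    HasPD (fun x y => c * f x y) x y a b (c * v) :=
  ((HasPD.const c).mul hf).val (by ring)

theorem HasPD.sum {ι : Type*} {s : Finset ι} {F : ι → E → E → ℝ} {V : ι → ℝ}
    (h : ∀ i ∈ s, HasPD (F i) x y a b (V i)) :
    HasPD (fun x y => ∑ i ∈ s, F i x y) x y a b (∑ i ∈ s, V i) := by
  have h' := HasFDerivAt.fun_sum (fun i hi => (h i hi).1.hasFDerivAt)
  refine ⟨h'.differentiableAt, ?_⟩
  refine (congrArg (fun l => l (a, b)) h'.fderiv).trans ?_
  rw [sum_apply]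
  exact Finset.sum_congr rfl fun i hi => (h i hi).2

/-- Chain rule for an outer function of one real variable. -/
theorem HasPD.comp {F : ℝ → ℝ} {F' : ℝ} (hF : HasDerivAt F F' (f x y))
    (hf : HasPD f x y a b v) : HasPD (fun x y => F (f x y)) x y a b (F' * v) := by
  have h := HasDerivAt.comp_hasFDerivAt (x, y) (h₂ := F) (f := Function.uncurry f) hF
    hf.1.hasFDerivAt
  refine ⟨h.differentiableAt, ?_⟩
  rw [← hf.2]
  exact congrArg (fun l => l (a, b)) h.fderiv

theorem HasPD.div (hf : HasPD f x y a b v) (hg : HasPD g x y a b w) (h : g x y ≠ 0) :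
    HasPD (fun x y => f x y / g x y) x y a b ((v - f x y / g x y * w) / g x y) := by
  simp only [div_eq_mul_inv (f _ _)]
  refine (hf.mul (hg.comp (hasDerivAt_inv h))).val ?_
  field_simp
  ring

theorem HasPD.pdFst_eq (h : HasPD f x y a 0 v) : pdFst a f x y = v := by
  rw [← h.2]
  have := HasFDerivAt.comp x (g := Function.uncurry f) (f := fun x' => (x', y))
    h.1.hasFDerivAt (hasFDerivAt_prodMk_left x y)
  exact congrArg (fun l => l a) this.fderiv

theorem HasPD.pdSnd_eq (h : HasPD f x y 0 b v) : pdSnd b f x y = v := by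
  rw [← h.2]
  have := HasFDerivAt.comp y (g := Function.uncurry f) (f := fun y' => (x, y'))
    h.1.hasFDerivAt (hasFDerivAt_prodMk_right x y)
  exact congrArg (fun l => l b) this.fderiv

theorem Smooth.differentiableAt (hf : Smooth S f) (hS : IsOpen S) (hp : (x, y) ∈ S) :
    DifferentiableAt ℝ (Function.uncurry f) (x, y) :=
  (hf.contDiffAt (hS.mem_nhds hp)).differentiableAt (by simp)

theorem Smooth.hasPD_fst (hf : Smooth S f) (hS : IsOpen S) (hp : (x, y) ∈ S) (a : E) :
    HasPD f x y a 0 (pdFst a f x y) := by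
  have h := hf.differentiableAt hS hp
  exact ⟨h, (HasPD.pdFst_eq ⟨h, rfl⟩).symm⟩

theorem Smooth.hasPD_snd (hf : Smooth S f) (hS : IsOpen S) (hp : (x, y) ∈ S) (b : E) :
    HasPD f x y 0 b (pdSnd b f x y) := by
  have h := hf.differentiableAt hS hp
  exact ⟨h, (HasPD.pdSnd_eq ⟨h, rfl⟩).symm⟩

theorem Smooth.congr (hf : Smooth S f) (h : ∀ x y, (x, y) ∈ S → g x y = f x y) : Smooth S g :=
  ContDiffOn.congr hf fun p hp => h p.1 p.2 hp

theorem pdFst_congr (hS : IsOpen S) (h : ∀ x y, (x, y) ∈ S → f x y = g x y) (a : E)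
    (hp : (x, y) ∈ S) : pdFst a f x y = pdFst a g x y := by
  have : (fun x' => f x' y) =ᶠ[nhds x] fun x' => g x' y := by
    have hc : Continuous fun x' : E => (x', y) := by fun_prop
    filter_upwards [hc.continuousAt.preimage_mem_nhds (hS.mem_nhds hp)] with x' hx' using h _ _ hx'
  simp only [pdFst, this.fderiv_eq]

theorem pdSnd_congr (hS : IsOpen S) (h : ∀ x y, (x, y) ∈ S → f x y = g x y) (b : E)
    (hp : (x, y) ∈ S) : pdSnd b f x y = pdSnd b g x y := by
  have : (fun y' => f x y') =ᶠ[nhds y] fun y' => g x y' := by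
    have hc : Continuous fun y' : E => (x, y') := by fun_prop
    filter_upwards [hc.continuousAt.preimage_mem_nhds (hS.mem_nhds hp)] with y' hy' using h _ _ hy'
  simp only [pdSnd, this.fderiv_eq]

theorem Smooth.fderiv_apply (hf : Smooth S f) (hS : IsOpen S) (c : E × E) :
    Smooth S (fun x y => fderiv ℝ (Function.uncurry f) (x, y) c) :=
  (ContDiffOn.fderiv_of_isOpen hf hS (m := ∞) (by simp)).clm_apply contDiffOn_const

theorem Smooth.pdFst (hf : Smooth S f) (hS : IsOpen S) (a : E) :
    Smooth S (WarpedFinsler.pdFst a f) :=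
  (hf.fderiv_apply hS (a, 0)).congr fun _ _ hp => (hf.hasPD_fst hS hp a).2.symm

theorem Smooth.pdSnd (hf : Smooth S f) (hS : IsOpen S) (b : E) :
    Smooth S (WarpedFinsler.pdSnd b f) :=
  (hf.fderiv_apply hS (0, b)).congr fun _ _ hp => (hf.hasPD_snd hS hp b).2.symm

theorem Smooth.fderiv_comm (hf : Smooth S f) (hS : IsOpen S) (hp : (x, y) ∈ S) (c d : E × E) :
    fderiv ℝ (fun p => fderiv ℝ (Function.uncurry f) p c) (x, y) d =
      fderiv ℝ (fun p => fderiv ℝ (Function.uncurry f) p d) (x, y) c := by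
  have h2 : ContDiffAt ℝ ∞ (Function.uncurry f) (x, y) := hf.contDiffAt (hS.mem_nhds hp)
  have hs := h2.isSymmSndFDerivAt
    (by simpa using (WithTop.coe_le_coe (a := ⊤) (b := (2 : ℕ∞))).2 le_top)
  have hd : DifferentiableAt ℝ (fderiv ℝ (Function.uncurry f)) (x, y) :=
    (h2.fderiv_right (m := 1) (by norm_cast)).differentiableAt (by simp)
  rw [fderiv_clm_apply hd (differentiableAt_const _), fderiv_clm_apply hd (differentiableAt_const _)]
  simpa using hs d c

theorem Smooth.fst_snd_comm (hf : Smooth S f) (hS : IsOpen S) (hp : (x, y) ∈ S) (a b : E) :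
    WarpedFinsler.pdFst a (WarpedFinsler.pdSnd b f) x y =
      WarpedFinsler.pdSnd b (WarpedFinsler.pdFst a f) x y := by
  rw [pdFst_congr hS (fun x y hp => (hf.hasPD_snd hS hp b).2.symm) a hp,
    pdSnd_congr hS (fun x y hp => (hf.hasPD_fst hS hp a).2.symm) b hp,
    ← ((hf.fderiv_apply hS (0, b)).hasPD_fst hS hp a).2,
    ← ((hf.fderiv_apply hS (a, 0)).hasPD_snd hS hp b).2]
  exact hf.fderiv_comm hS hp _ _

theorem Smooth.snd_snd_comm (hf : Smooth S f) (hS : IsOpen S) (hp : (x, y) ∈ S) (a b : E) :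
    WarpedFinsler.pdSnd a (WarpedFinsler.pdSnd b f) x y =
      WarpedFinsler.pdSnd b (WarpedFinsler.pdSnd a f) x y := by
  rw [pdSnd_congr hS (fun x y hp => (hf.hasPD_snd hS hp b).2.symm) a hp,
    pdSnd_congr hS (fun x y hp => (hf.hasPD_snd hS hp a).2.symm) b hp,
    ← ((hf.fderiv_apply hS (0, b)).hasPD_snd hS hp a).2,
    ← ((hf.fderiv_apply hS (0, a)).hasPD_snd hS hp b).2]
  exact hf.fderiv_comm hS hp _ _

theorem Smooth.add (hf : Smooth S f) (hg : Smooth S g) : Smooth S fun x y => f x y + g x y :=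
  ContDiffOn.add hf hg

theorem Smooth.sub (hf : Smooth S f) (hg : Smooth S g) : Smooth S fun x y => f x y - g x y :=
  ContDiffOn.sub hf hg

theorem Smooth.mul (hf : Smooth S f) (hg : Smooth S g) : Smooth S fun x y => f x y * g x y :=
  ContDiffOn.mul hf hg

theorem Smooth.div (hf : Smooth S f) (hg : Smooth S g) (h : ∀ x y, (x, y) ∈ S → g x y ≠ 0) :
    Smooth S fun x y => f x y / g x y :=
  ContDiffOn.div hf hg fun p hp => h p.1 p.2 hp

theorem Smooth.const (c : ℝ) : Smooth S fun _ _ => c := contDiffOn_const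

theorem Smooth.sum {ι : Type*} {s : Finset ι} {F : ι → E → E → ℝ}
    (h : ∀ i ∈ s, Smooth S (F i)) : Smooth S fun x y => ∑ i ∈ s, F i x y :=
  ContDiffOn.sum h

end Calculus

theorem dz_eq_pdFst (f : ℝ → ℝ → ℝ) : dz f = pdFst 1 f := rfl

theorem dr_eq_pdSnd (f : ℝ → ℝ → ℝ) : dr f = pdSnd 1 f := rfl

theorem dx_eq_pdFst {n : ℕ} (A : Fin (n + 1)) (f : Coord n → Coord n → ℝ) :
    dx A f = pdFst (Pi.single A 1) f := rfl

theorem dy_eq_pdSnd {n : ℕ} (A : Fin (n + 1)) (f : Coord n → Coord n → ℝ) :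
    dy A f = pdSnd (Pi.single A 1) f := rfl

/-- Chain rule for an outer function of the two real variables `(z, ρ)`. -/
theorem HasPD.comp₂ {E : Type*} [NormedAddCommGroup E] [NormedSpace ℝ E] {f g : E → E → ℝ}
    {x y a b : E} {v w : ℝ} {D : Set (ℝ × ℝ)} {F : ℝ → ℝ → ℝ} (hF : Smooth D F) (hD : IsOpen D)
    (hp : (f x y, g x y) ∈ D) (hf : HasPD f x y a b v) (hg : HasPD g x y a b w) :
    HasPD (fun x y => F (f x y) (g x y)) x y a b
      (dz F (f x y) (g x y) * v + dr F (f x y) (g x y) * w) := by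
  have hd := hF.differentiableAt hD hp
  have h := HasFDerivAt.comp (x, y) (g := Function.uncurry F)
    (f := fun p : E × E => (Function.uncurry f p, Function.uncurry g p)) hd.hasFDerivAt
    (hf.1.hasFDerivAt.prodMk hg.1.hasFDerivAt)
  refine ⟨h.differentiableAt, (congrArg (fun l => l (a, b)) h.fderiv).trans ?_⟩
  rw [dz_eq_pdFst, dr_eq_pdSnd, ← (hF.hasPD_fst hD hp 1).2, ← (hF.hasPD_snd hD hp 1).2,
    mul_comm _ v, mul_comm _ w, ← smul_eq_mul, ← smul_eq_mul, ← map_smul, ← map_smul, ← map_add,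
    ← hf.2, ← hg.2]
  simp

/-! ### The coordinate functions `α`, `z`, `ρ` and `x^m y^m` -/

section Coordinates

variable {n : ℕ}

theorem spDot_comm (x y : Coord n) : spDot x y = spDot y x :=
  Finset.sum_congr rfl fun _ _ => mul_comm _ _

theorem spDot_self (x : Coord n) : spDot x x = spNorm x ^ 2 := by
  rw [spNorm, Real.sq_sqrt (Finset.sum_nonneg fun _ _ => sq_nonneg _)]
  exact Finset.sum_congr rfl fun _ _ => by ring

@[simp] theorem spDot_single_zero (x : Coord n) : spDot x (Pi.single 0 1) = 0 := by
  simp [spDot]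

@[simp] theorem spDot_single_succ (x : Coord n) (i : Fin n) :
    spDot x (Pi.single i.succ 1) = x i.succ := by
  simp [spDot, Pi.single_apply]

@[simp] theorem zero_spDot (x : Coord n) : spDot 0 x = 0 := by simp [spDot]

@[simp] theorem spDot_zero (x : Coord n) : spDot x 0 = 0 := by simp [spDot]

variable {x y a b : Coord n}

theorem hasPD_fst_apply (A : Fin (n + 1)) :
    HasPD (fun x _ : Coord n => x A) x y a b (a A) := by
  have h := ((ContinuousLinearMap.proj (R := ℝ) (φ := fun _ : Fin (n + 1) => ℝ) A).comp
    (ContinuousLinearMap.fst ℝ (Coord n) (Coord n))).hasFDerivAt (x := (x, y))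
  exact ⟨h.differentiableAt, congrArg (fun l => l (a, b)) h.fderiv⟩

theorem hasPD_snd_apply (A : Fin (n + 1)) :
    HasPD (fun _ y : Coord n => y A) x y a b (b A) := by
  have h := ((ContinuousLinearMap.proj (R := ℝ) (φ := fun _ : Fin (n + 1) => ℝ) A).comp
    (ContinuousLinearMap.snd ℝ (Coord n) (Coord n))).hasFDerivAt (x := (x, y))
  exact ⟨h.differentiableAt, congrArg (fun l => l (a, b)) h.fderiv⟩

theorem hasPD_spDot : HasPD (fun x y : Coord n => spDot x y) x y a b (spDot a y + spDot x b) := by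
  refine (HasPD.sum fun i _ => (hasPD_fst_apply i.succ).mul (hasPD_snd_apply i.succ)).val ?_
  simp [spDot, Finset.sum_add_distrib]

theorem hasPD_fst_spDot (v : Coord n) :
    HasPD (fun x _ : Coord n => spDot x v) x y a b (spDot a v) := by
  refine (HasPD.sum fun i _ => (hasPD_fst_apply i.succ).mul (HasPD.const (v i.succ))).val ?_
  simp [spDot]

theorem hasPD_snd_spDot (v : Coord n) :
    HasPD (fun _ y : Coord n => spDot y v) x y a b (spDot b v) := by
  refine (HasPD.sum fun i _ => (hasPD_snd_apply i.succ).mul (HasPD.const (v i.succ))).val ?_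
  simp [spDot]

theorem hasPD_fst_spNorm (h : spNorm x ≠ 0) :
    HasPD (fun x _ : Coord n => spNorm x) x y a b (spDot x a / spNorm x) := by
  have h1 : HasPD (fun x _ : Coord n => ∑ i : Fin n, x i.succ * x i.succ) x y a b
      (2 * spDot x a) := by
    refine (HasPD.sum fun i _ => (hasPD_fst_apply i.succ).mul (hasPD_fst_apply i.succ)).val ?_
    simp only [spDot, Finset.mul_sum]
    exact Finset.sum_congr rfl fun _ _ => by ring
  have h2 : (∑ i : Fin n, x i.succ * x i.succ) ≠ 0 := by
    have := spDot_self x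
    rw [spDot] at this
    rw [this]
    exact pow_ne_zero 2 h
  have h3 := h1.comp (Real.hasDerivAt_sqrt h2)
  simp only [spNorm, pow_two] at h ⊢
  refine h3.val ?_
  field_simp

theorem hasPD_snd_spNorm (h : spNorm y ≠ 0) :
    HasPD (fun _ y : Coord n => spNorm y) x y a b (spDot y b / spNorm y) := by
  have h1 : HasPD (fun _ y : Coord n => ∑ i : Fin n, y i.succ * y i.succ) x y a b
      (2 * spDot y b) := by
    refine (HasPD.sum fun i _ => (hasPD_snd_apply i.succ).mul (hasPD_snd_apply i.succ)).val ?_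
    simp only [spDot, Finset.mul_sum]
    exact Finset.sum_congr rfl fun _ _ => by ring
  have h2 : (∑ i : Fin n, y i.succ * y i.succ) ≠ 0 := by
    have := spDot_self y
    rw [spDot] at this
    rw [this]
    exact pow_ne_zero 2 h
  have h3 := h1.comp (Real.hasDerivAt_sqrt h2)
  simp only [spNorm, pow_two] at h ⊢
  refine h3.val ?_
  field_simp

theorem hasPD_zOf (h : spNorm y ≠ 0) :
    HasPD (fun _ y : Coord n => zOf y) x y a b
      ((b 0 - zOf y * (spDot y b / spNorm y)) / spNorm y) :=
  (hasPD_snd_apply 0).div (hasPD_snd_spNorm h) h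

/-- The set of pairs `(x, y)` lying over `D`. -/
def OverSet (n : ℕ) (D : Set (ℝ × ℝ)) : Set (Coord n × Coord n) := {p | Over D p.1 p.2}

theorem continuous_spNorm : Continuous (spNorm : Coord n → ℝ) := by
  unfold spNorm
  fun_prop

variable {D : Set (ℝ × ℝ)}

theorem isOpen_overSet (hD : IsOpen D) : IsOpen (OverSet n D) := by
  have h1 : IsOpen {p : Coord n × Coord n | spNorm p.2 ≠ 0} :=
    isOpen_ne_fun (continuous_spNorm.comp continuous_snd) continuous_const
  have h2 : ContinuousOn (fun p : Coord n × Coord n => (zOf p.2, spNorm p.1))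
      {p : Coord n × Coord n | spNorm p.2 ≠ 0} := by
    refine ContinuousOn.prodMk (ContinuousOn.div (by fun_prop) ?_ fun p hp => hp) ?_
    · exact (continuous_spNorm.comp continuous_snd).continuousOn
    · exact (continuous_spNorm.comp continuous_fst).continuousOn
  exact h2.isOpen_inter_preimage h1 hD

theorem smooth_fst_apply (S : Set (Coord n × Coord n)) (A : Fin (n + 1)) :
    Smooth S fun x _ => x A :=
  ContDiff.contDiffOn (((ContinuousLinearMap.proj (R := ℝ) (φ := fun _ : Fin (n + 1) => ℝ) A).comp
    (ContinuousLinearMap.fst ℝ (Coord n) (Coord n))).contDiff)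

theorem smooth_snd_apply (S : Set (Coord n × Coord n)) (A : Fin (n + 1)) :
    Smooth S fun _ y => y A :=
  ContDiff.contDiffOn (((ContinuousLinearMap.proj (R := ℝ) (φ := fun _ : Fin (n + 1) => ℝ) A).comp
    (ContinuousLinearMap.snd ℝ (Coord n) (Coord n))).contDiff)

theorem smooth_spDot (S : Set (Coord n × Coord n)) : Smooth S fun x y => spDot x y :=
  Smooth.sum fun i _ => (smooth_fst_apply S i.succ).mul (smooth_snd_apply S i.succ)

theorem smooth_fst_spDot (S : Set (Coord n × Coord n)) (v : Coord n) :
    Smooth S fun x _ => spDot x v :=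
  Smooth.sum fun i _ => (smooth_fst_apply S i.succ).mul (Smooth.const _)

theorem smooth_snd_spDot (S : Set (Coord n × Coord n)) (v : Coord n) :
    Smooth S fun _ y => spDot y v :=
  Smooth.sum fun i _ => (smooth_snd_apply S i.succ).mul (Smooth.const _)

theorem smooth_fst_spNorm (hpos : ∀ p ∈ D, 0 < p.2) :
    Smooth (OverSet n D) fun x _ => spNorm x := by
  refine ContDiffOn.sqrt (f := fun p : Coord n × Coord n => ∑ i : Fin n, p.1 i.succ ^ 2)
    (ContDiffOn.sum fun i _ => (smooth_fst_apply _ i.succ).pow 2) fun p hp h0 => ?_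
  have := hpos _ hp.2
  simp [spNorm, h0] at this

theorem smooth_snd_spNorm : Smooth (OverSet n D) fun _ y => spNorm y := by
  refine ContDiffOn.sqrt (f := fun p : Coord n × Coord n => ∑ i : Fin n, p.2 i.succ ^ 2)
    (ContDiffOn.sum fun i _ => (smooth_snd_apply _ i.succ).pow 2) fun p hp h0 => hp.1 ?_
  simp [spNorm, h0]

theorem smooth_zOf : Smooth (OverSet n D) fun _ y => zOf y :=
  (smooth_snd_apply _ 0).div smooth_snd_spNorm fun _ _ hp => hp.1

theorem Smooth.over {F : ℝ → ℝ → ℝ} (hF : Smooth D F) (hpos : ∀ p ∈ D, 0 < p.2) :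
    Smooth (OverSet n D) fun x y => F (zOf y) (spNorm x) :=
  ContDiffOn.comp hF (smooth_zOf.prodMk (smooth_fst_spNorm hpos)) fun _ hp => hp.2

/-- Chain rule for a function of `(z, ρ)`. -/
theorem Smooth.hasPD_over {F : ℝ → ℝ → ℝ} (hF : Smooth D F) (hD : IsOpen D)
    (hpos : ∀ p ∈ D, 0 < p.2) (h : Over D x y) :
    HasPD (fun x y : Coord n => F (zOf y) (spNorm x)) x y a b
      (dz F (zOf y) (spNorm x) * ((b 0 - zOf y * (spDot y b / spNorm y)) / spNorm y)
        + dr F (zOf y) (spNorm x) * (spDot x a / spNorm x)) :=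
  HasPD.comp₂ hF hD h.2 (hasPD_zOf h.1) (hasPD_fst_spNorm (hpos _ h.2).ne')

end Coordinates

/-! ### The functions `Ω`, `Λ`, `U`, `V`, `W`, `Ψ` -/

section Scalars

variable {φ f g : ℝ → ℝ → ℝ} {D : Set (ℝ × ℝ)} {z ρ : ℝ}

theorem Smooth.dz (hf : Smooth D f) (hD : IsOpen D) : Smooth D (dz f) := Smooth.pdFst hf hD 1

theorem Smooth.dr (hf : Smooth D f) (hD : IsOpen D) : Smooth D (dr f) := Smooth.pdSnd hf hD 1

theorem dz_congr (hD : IsOpen D) (h : ∀ z ρ, (z, ρ) ∈ D → f z ρ = g z ρ) (hp : (z, ρ) ∈ D) :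
    dz f z ρ = dz g z ρ := pdFst_congr hD h 1 hp

theorem dr_congr (hD : IsOpen D) (h : ∀ z ρ, (z, ρ) ∈ D → f z ρ = g z ρ) (hp : (z, ρ) ∈ D) :
    dr f z ρ = dr g z ρ := pdSnd_congr hD h 1 hp

theorem Smooth.dz_dr_comm (hf : Smooth D f) (hD : IsOpen D) (hp : (z, ρ) ∈ D) :
    WarpedFinsler.dz (WarpedFinsler.dr f) z ρ = WarpedFinsler.dr (WarpedFinsler.dz f) z ρ :=
  hf.fst_snd_comm hD hp 1 1

theorem smooth_z : Smooth D fun z _ => z := contDiff_fst.contDiffOn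

theorem smooth_r : Smooth D fun _ ρ => ρ := contDiff_snd.contDiffOn

theorem IsRegularDomain.smooth_Om (hD : IsRegularDomain φ D) : Smooth D (Om φ) :=
  ((Smooth.const 2).mul hD.smooth).sub (smooth_z.mul (Smooth.dz hD.smooth hD.isOpen))

theorem IsRegularDomain.smooth_Lam (hD : IsRegularDomain φ D) : Smooth D (Lam φ) := by
  have h1 : Smooth D (dz φ) := Smooth.dz hD.smooth hD.isOpen
  exact (((Smooth.const 2).mul hD.smooth).mul (h1.dz hD.isOpen)).sub (ContDiffOn.pow h1 2)

theorem IsRegularDomain.smooth_V (hD : IsRegularDomain φ D) : Smooth D (V φ) := by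
  have h1 : Smooth D (dz φ) := Smooth.dz hD.smooth hD.isOpen
  have h2 : Smooth D (dr φ) := Smooth.dr hD.smooth hD.isOpen
  refine Smooth.mul (Smooth.div (Smooth.const 1)
    (((Smooth.const 2).mul smooth_r).mul hD.smooth_Lam) fun z ρ hp => ?_) ?_
  · exact mul_ne_zero (mul_ne_zero two_ne_zero (hD.pos _ hp).ne') (hD.lam_ne _ hp)
  · exact (h2.mul (h1.dz hD.isOpen)).sub (h1.mul (h1.dr hD.isOpen))

theorem IsRegularDomain.smooth_U (hD : IsRegularDomain φ D) : Smooth D (U φ) := by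
  have h1 : Smooth D (dz φ) := Smooth.dz hD.smooth hD.isOpen
  have h2 : Smooth D (dr φ) := Smooth.dr hD.smooth hD.isOpen
  refine Smooth.mul (Smooth.div (Smooth.const 1)
    (((Smooth.const 2).mul smooth_r).mul hD.smooth_Lam) fun z ρ hp => ?_) ?_
  · exact mul_ne_zero (mul_ne_zero two_ne_zero (hD.pos _ hp).ne') (hD.lam_ne _ hp)
  · exact (((Smooth.const 2).mul hD.smooth).mul (h1.dr hD.isOpen)).sub (h1.mul h2)

theorem IsRegularDomain.smooth_W (hD : IsRegularDomain φ D) : Smooth D (W φ) := by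
  refine Smooth.mul (Smooth.div (Smooth.const 1)
    (((Smooth.const 2).mul smooth_r).mul hD.smooth_Om) fun z ρ hp => ?_) ?_
  · exact mul_ne_zero (mul_ne_zero two_ne_zero (hD.pos _ hp).ne') (hD.om_ne _ hp)
  · exact Smooth.dr hD.smooth hD.isOpen

theorem IsRegularDomain.smooth_Psi (hD : IsRegularDomain φ D) (n : ℕ) : Smooth D (Psi n φ) :=
  ((hD.smooth_U.dz hD.isOpen).add ((Smooth.const _).mul hD.smooth_V)).add
    ((Smooth.const _).mul hD.smooth_W)

theorem IsRegularDomain.dz_Om (hD : IsRegularDomain φ D) (hp : (z, ρ) ∈ D) :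
    dz (Om φ) z ρ = dz φ z ρ - z * dz (dz φ) z ρ := by
  have h0 : Smooth D φ := hD.smooth
  have h1 := h0.hasPD_fst hD.isOpen hp 1
  have h2 := (h0.dz hD.isOpen).hasPD_fst hD.isOpen hp 1
  have hz := (smooth_z (D := D)).hasPD_fst hD.isOpen hp 1
  have hz1 : pdFst (1 : ℝ) (fun z _ : ℝ => z) z ρ = 1 := deriv_id z
  rw [hz1] at hz
  refine ((HasPD.const_mul 2 h1).sub (hz.mul h2)).pdFst_eq.trans ?_
  simp only [dz_eq_pdFst]
  ring

theorem IsRegularDomain.dr_Om (hD : IsRegularDomain φ D) (hp : (z, ρ) ∈ D) :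
    dr (Om φ) z ρ = 2 * dr φ z ρ - z * dr (dz φ) z ρ := by
  have h0 : Smooth D φ := hD.smooth
  have h1 := h0.hasPD_snd hD.isOpen hp 1
  have h2 := (h0.dz hD.isOpen).hasPD_snd hD.isOpen hp 1
  have hz := (smooth_z (D := D)).hasPD_snd hD.isOpen hp 1
  have hz1 : pdSnd (1 : ℝ) (fun z _ : ℝ => z) z ρ = 0 := deriv_const ρ z
  rw [hz1] at hz
  refine ((HasPD.const_mul 2 h1).sub (hz.mul h2)).pdSnd_eq.trans ?_
  simp only [dr_eq_pdSnd]
  ring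

end Scalars

/-! ### The spray of the metric -/

section Spray

variable {n : ℕ} {φ : ℝ → ℝ → ℝ} {D : Set (ℝ × ℝ)} {x y a b : Coord n}

theorem sum_pdSnd_single_mul (f : Coord n → Coord n → ℝ) (x y v : Coord n) :
    ∑ A, pdSnd (Pi.single A 1) f x y * v A = pdSnd v f x y := by
  have h := LinearMap.pi_apply_eq_sum_univ
    (fderiv ℝ (fun y' => f x y') y : Coord n →L[ℝ] ℝ).toLinearMap v
  refine Eq.trans ?_ h.symm
  refine Finset.sum_congr rfl fun A _ => ?_
  rw [smul_eq_mul, mul_comm]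
  congr 2
  ext j
  simp [Pi.single_apply, eq_comm]

theorem sum_pdFst_single_mul (f : Coord n → Coord n → ℝ) (x y v : Coord n) :
    ∑ A, pdFst (Pi.single A 1) f x y * v A = pdFst v f x y := by
  have h := LinearMap.pi_apply_eq_sum_univ
    (fderiv ℝ (fun x' => f x' y) x : Coord n →L[ℝ] ℝ).toLinearMap v
  refine Eq.trans ?_ h.symm
  refine Finset.sum_congr rfl fun A _ => ?_
  rw [smul_eq_mul, mul_comm]
  congr 2
  ext j
  simp [Pi.single_apply, eq_comm]

theorem IsRegularDomain.hasPD_metricL (hD : IsRegularDomain φ D) (h : Over D x y) :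
    HasPD (metricL φ) x y a b
      (spDot y b * Om φ (zOf y) (spNorm x) + spNorm y * b 0 * dz φ (zOf y) (spNorm x)
        + spNorm y ^ 2 * dr φ (zOf y) (spNorm x) * (spDot x a / spNorm x)) := by
  have h0 : Smooth D φ := hD.smooth
  refine ((hasPD_snd_spNorm h.1).sq.mul (h0.hasPD_over hD.isOpen hD.pos h)).val ?_
  have := h.1
  simp only [Om]
  field_simp
  ring

theorem IsRegularDomain.pdSnd_metricL (hD : IsRegularDomain φ D) (v x y : Coord n)
    (h : (x, y) ∈ OverSet n D) :
    pdSnd v (metricL φ) x y =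
      spDot y v * Om φ (zOf y) (spNorm x) + v 0 * (spNorm y * dz φ (zOf y) (spNorm x)) := by
  rw [((hD.hasPD_metricL h).val rfl).pdSnd_eq]
  simp
  ring

theorem IsRegularDomain.pdFst_metricL (hD : IsRegularDomain φ D) (v x y : Coord n)
    (h : (x, y) ∈ OverSet n D) :
    pdFst v (metricL φ) x y =
      spNorm y ^ 2 * dr φ (zOf y) (spNorm x) * (spDot x v / spNorm x) := by
  rw [((hD.hasPD_metricL h).val rfl).pdFst_eq]
  simp

/-- All second derivatives of `L` with at least one fibre direction. The factors in the
parentheses are the derivatives of `z` and `ρ` in the direction `(a, b)`. -/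
theorem IsRegularDomain.hasPD_pdSnd_metricL (hD : IsRegularDomain φ D) (h : Over D x y)
    (v : Coord n) :
    HasPD (fun x y : Coord n => spDot y v * Om φ (zOf y) (spNorm x)
        + v 0 * (spNorm y * dz φ (zOf y) (spNorm x))) x y a b
      (spDot b v * Om φ (zOf y) (spNorm x)
        + spDot y v * (dz (Om φ) (zOf y) (spNorm x)
              * ((b 0 - zOf y * (spDot y b / spNorm y)) / spNorm y)
            + dr (Om φ) (zOf y) (spNorm x) * (spDot x a / spNorm x))
        + v 0 * (spDot y b / spNorm y * dz φ (zOf y) (spNorm x)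
          + spNorm y * (dz (dz φ) (zOf y) (spNorm x)
              * ((b 0 - zOf y * (spDot y b / spNorm y)) / spNorm y)
            + dr (dz φ) (zOf y) (spNorm x) * (spDot x a / spNorm x)))) := by
  have h0 : Smooth D φ := hD.smooth
  have h1 := (h0.dz hD.isOpen).hasPD_over (a := a) (b := b) hD.isOpen hD.pos h
  have h2 := hD.smooth_Om.hasPD_over (a := a) (b := b) hD.isOpen hD.pos h
  exact (((hasPD_snd_spDot v).mul h2).add
    (HasPD.const_mul (v 0) ((hasPD_snd_spNorm h.1).mul h1))).val (by ring)

/-- `G(v) = G^A v_A` for the spray `G⁰ = s α (U + z V)`, `Gⁱ = s (V + W) yⁱ - α² W xⁱ`, where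
`s = x^m y^m`. -/
def sprayForm (φ : ℝ → ℝ → ℝ) (v x y : Coord n) : ℝ :=
  spDot x y * spNorm y * (U φ (zOf y) (spNorm x) + zOf y * V φ (zOf y) (spNorm x)) * v 0
    + spDot x y * (V φ (zOf y) (spNorm x) + W φ (zOf y) (spNorm x)) * spDot y v
    - spNorm y ^ 2 * W φ (zOf y) (spNorm x) * spDot x v

/-- The vector with the components `sprayForm`. -/
def sprayVec (φ : ℝ → ℝ → ℝ) (x y : Coord n) : Coord n :=
  fun A => sprayForm φ (Pi.single A 1) x y

theorem sprayVec_zero (φ : ℝ → ℝ → ℝ) (x y : Coord n) : sprayVec φ x y 0 =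
    spDot x y * spNorm y * (U φ (zOf y) (spNorm x) + zOf y * V φ (zOf y) (spNorm x)) := by
  simp [sprayVec, sprayForm]

theorem sprayVec_succ (φ : ℝ → ℝ → ℝ) (x y : Coord n) (i : Fin n) : sprayVec φ x y i.succ =
    spDot x y * (V φ (zOf y) (spNorm x) + W φ (zOf y) (spNorm x)) * y i.succ
    - spNorm y ^ 2 * W φ (zOf y) (spNorm x) * x i.succ := by
  simp [sprayVec, sprayForm]

theorem spDot_sprayVec (φ : ℝ → ℝ → ℝ) (x y v : Coord n) : spDot v (sprayVec φ x y) =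
    spDot x y * (V φ (zOf y) (spNorm x) + W φ (zOf y) (spNorm x)) * spDot y v
    - spNorm y ^ 2 * W φ (zOf y) (spNorm x) * spDot x v := by
  have h : ∀ c d : ℝ, ∑ i : Fin n, v i.succ * (c * y i.succ - d * x i.succ)
      = c * spDot y v - d * spDot x v := fun c d => by
    simp only [spDot, Finset.mul_sum, ← Finset.sum_sub_distrib]
    exact Finset.sum_congr rfl fun i _ => by ring
  rw [← h]
  exact Finset.sum_congr rfl fun i _ => by rw [sprayVec_succ]

theorem spDot_snd_sprayVec (φ : ℝ → ℝ → ℝ) (x y : Coord n) : spDot y (sprayVec φ x y) =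
    spDot x y * spNorm y ^ 2 * V φ (zOf y) (spNorm x) := by
  rw [spDot_sprayVec, spDot_self]
  ring

theorem spDot_fst_sprayVec (φ : ℝ → ℝ → ℝ) (x y : Coord n) : spDot x (sprayVec φ x y) =
    spDot x y ^ 2 * (V φ (zOf y) (spNorm x) + W φ (zOf y) (spNorm x))
      - spNorm y ^ 2 * spNorm x ^ 2 * W φ (zOf y) (spNorm x) := by
  rw [spDot_sprayVec, spDot_self, spDot_comm y x]
  ring

/-- The derivative of `z` along the spray. -/
theorem zOf_sprayVec (φ : ℝ → ℝ → ℝ) (x y : Coord n) (h : spNorm y ≠ 0) :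
    (sprayVec φ x y 0 - zOf y * (spDot y (sprayVec φ x y) / spNorm y)) / spNorm y
      = spDot x y * U φ (zOf y) (spNorm x) := by
  rw [spDot_snd_sprayVec, sprayVec_zero]
  field_simp
  ring

section ScalarIdentities

variable {z ρ : ℝ}

theorem IsRegularDomain.W_mul_Om (hD : IsRegularDomain φ D) (hp : (z, ρ) ∈ D) :
    W φ z ρ * Om φ z ρ = dr φ z ρ / (2 * ρ) := by
  have h1 := hD.om_ne _ hp
  have h2 := hD.pos _ hp
  simp only at h1 h2
  rw [W]
  field_simp

theorem IsRegularDomain.U_mul_add (hD : IsRegularDomain φ D) (hp : (z, ρ) ∈ D) :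
    U φ z ρ * dz (dz φ) z ρ + V φ z ρ * dz φ z ρ = dr (dz φ) z ρ / (2 * ρ) := by
  have h1 := hD.lam_ne _ hp
  have h2 := hD.pos _ hp
  simp only at h1 h2
  rw [U, V]
  field_simp
  rw [Lam]
  ring

theorem IsRegularDomain.U_mul_dz_Om_add (hD : IsRegularDomain φ D) (hp : (z, ρ) ∈ D) :
    U φ z ρ * dz (Om φ) z ρ + V φ z ρ * Om φ z ρ
      = (dr (Om φ) z ρ - dr φ z ρ) / (2 * ρ) := by
  have h1 := hD.lam_ne _ hp
  have h2 := hD.pos _ hp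
  simp only at h1 h2
  rw [hD.dz_Om hp, hD.dr_Om hp, U, V]
  field_simp
  rw [Lam, Om]
  ring

end ScalarIdentities

theorem IsRegularDomain.fundTensor_mulVec (hD : IsRegularDomain φ D) (h : Over D x y)
    (v : Coord n) (A : Fin (n + 1)) :
    (fundTensor (metricL φ) x y).mulVec v A =
      1 / 2 * pdSnd v (fun x y : Coord n =>
        spDot y (Pi.single A 1) * Om φ (zOf y) (spNorm x)
          + (Pi.single A 1 : Coord n) 0 * (spNorm y * dz φ (zOf y) (spNorm x))) x y := by
  simp only [Matrix.mulVec, dotProduct, fundTensor, Matrix.of_apply, mul_assoc,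
    ← Finset.mul_sum, dy_eq_pdSnd]
  rw [sum_pdSnd_single_mul, pdSnd_congr (isOpen_overSet hD.isOpen)
    (hD.pdSnd_metricL (Pi.single A 1)) v h]

/-- The fundamental tensor is `Ω / 2` times the Euclidean metric on the vectors `v` with `v⁰ = 0`
and `v̄ ⟂ ȳ`, and a `2 × 2` block of determinant `Λ / 4` on the plane of `(1, 0)` and `(0, ȳ)`. -/
theorem IsRegularDomain.isUnit_fundTensor (hD : IsRegularDomain φ D) (h : Over D x y) :
    IsUnit (fundTensor (metricL φ) x y) := by
  rw [← Matrix.mulVec_injective_iff_isUnit]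
  have key : ∀ v : Coord n, (fundTensor (metricL φ) x y).mulVec v = 0 → v = 0 := by
    intro v hv
    have hα := h.1
    have hM : ∀ A : Fin (n + 1), _ := fun A => by
      have h1 := congrFun hv A
      rw [hD.fundTensor_mulVec h, (hD.hasPD_pdSnd_metricL h _).pdSnd_eq] at h1
      exact h1
    set t := (v 0 - zOf y * (spDot y v / spNorm y)) / spNorm y with ht
    clear_value t
    have h0 := hM 0
    have hs : ∀ i : Fin n, v i.succ * Om φ (zOf y) (spNorm x)
        + y i.succ * (dz (Om φ) (zOf y) (spNorm x) * t) = 0 := fun i => by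
      have := hM i.succ
      simp at this
      linarith
    simp at h0
    have hsum : spDot y v * Om φ (zOf y) (spNorm x)
        + spNorm y ^ 2 * (dz (Om φ) (zOf y) (spNorm x) * t) = 0 := by
      have h2 : ∑ i : Fin n, y i.succ * (v i.succ * Om φ (zOf y) (spNorm x)
        + y i.succ * (dz (Om φ) (zOf y) (spNorm x) * t)) = 0 := by simp [hs]
      rw [← h2, ← spDot_self]
      simp only [spDot, Finset.sum_mul, ← Finset.sum_add_distrib]
      exact Finset.sum_congr rfl fun _ _ => by ring
    have h0' : spDot y v * dz φ (zOf y) (spNorm x)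
        + spNorm y ^ 2 * (dz (dz φ) (zOf y) (spNorm x) * t) = 0 := by
      field_simp at h0
      linarith
    have hL := hD.lam_ne _ h.2
    have hO := hD.om_ne _ h.2
    rw [hD.dz_Om h.2] at hsum hs
    simp only at hL hO
    have e1 : Lam φ (zOf y) (spNorm x) * spDot y v = 0 := by
      simp only [Lam, Om] at hsum ⊢
      linear_combination (dz (dz φ) (zOf y) (spNorm x)) * hsum
        - (dz φ (zOf y) (spNorm x) - zOf y * dz (dz φ) (zOf y) (spNorm x)) * h0'
    have e2 : Lam φ (zOf y) (spNorm x) * (spNorm y ^ 2 * t) = 0 := by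
      simp only [Lam, Om] at hsum ⊢
      linear_combination (2 * φ (zOf y) (spNorm x)
        - zOf y * dz φ (zOf y) (spNorm x)) * h0' - dz φ (zOf y) (spNorm x) * hsum
    have e3 : spDot y v = 0 := (mul_eq_zero.1 e1).resolve_left hL
    have e4 : t = 0 :=
      (mul_eq_zero.1 ((mul_eq_zero.1 e2).resolve_left hL)).resolve_left (pow_ne_zero 2 hα)
    ext A
    refine Fin.cases ?_ (fun i => ?_) A
    · rw [e4, e3] at ht
      simpa [hα] using ht.symm
    · have := hs i
      rw [e4] at this
      simpa [hO] using this
  intro v w hvw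
  have h1 := key (v - w) (by rw [Matrix.mulVec_sub]; exact sub_eq_zero.2 hvw)
  exact sub_eq_zero.1 h1

theorem IsRegularDomain.spray_eq (hD : IsRegularDomain φ D) (C : Fin (n + 1)) (x y : Coord n)
    (h : (x, y) ∈ OverSet n D) :
    spray (metricL φ) C x y = sprayForm φ (Pi.single C 1) x y := by
  have h' : Over D x y := h
  have hα := h'.1
  have hρ := (hD.pos _ h'.2).ne'
  have hS := isOpen_overSet (n := n) hD.isOpen
  have hdet : IsUnit (fundTensor (metricL φ) x y).det :=
    (Matrix.isUnit_iff_isUnit_det _).1 (hD.isUnit_fundTensor h)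
  have hrhs : (fun A => (∑ B, dx B (dy A (metricL φ)) x y * y B) - dx A (metricL φ) x y)
      = (4 : ℝ) • (fundTensor (metricL φ) x y).mulVec (sprayVec φ x y) := by
    ext A
    simp only [Pi.smul_apply, smul_eq_mul, dx_eq_pdFst, dy_eq_pdSnd]
    rw [hD.fundTensor_mulVec h, sum_pdFst_single_mul,
      pdFst_congr hS (hD.pdSnd_metricL (Pi.single A 1)) y h, hD.pdFst_metricL _ x y h,
      (hD.hasPD_pdSnd_metricL h _).pdFst_eq, (hD.hasPD_pdSnd_metricL h _).pdSnd_eq,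
      zOf_sprayVec φ x y hα, spDot_snd_sprayVec, spDot_comm (sprayVec φ x y), spDot_sprayVec]
    have i1 := hD.W_mul_Om h'.2
    have i2 := hD.U_mul_add h'.2
    have i3 := hD.U_mul_dz_Om_add h'.2
    generalize (Pi.single A 1 : Coord n) = v
    simp only [spDot_zero, zero_spDot, Pi.zero_apply]
    have i4 : spDot x y * spNorm y ^ 2 * V φ (zOf y) (spNorm x) / spNorm y
        = spDot x y * spNorm y * V φ (zOf y) (spNorm x) := by field_simp
    rw [i4]
    linear_combination (-2 * spDot x y * spDot y v) * (i1 + i3)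
      - 2 * v 0 * spNorm y * spDot x y * i2 + 2 * spNorm y ^ 2 * spDot x v * i1
  have hG : spray (metricL φ) C x y = 1 / 4 * ((fundTensor (metricL φ) x y)⁻¹.mulVec
      (fun A => (∑ B, dx B (dy A (metricL φ)) x y * y B) - dx A (metricL φ) x y)) C := rfl
  rw [hG, hrhs, Matrix.mulVec_smul, Matrix.mulVec_mulVec, Matrix.nonsing_inv_mul _ hdet,
    Matrix.one_mulVec]
  simp [sprayVec]

end Spray

/-! ### The mean Berwald term and the χ-curvature -/

section MeanBerwald

variable {n : ℕ} {φ : ℝ → ℝ → ℝ} {D : Set (ℝ × ℝ)} {x y a b : Coord n}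

theorem IsRegularDomain.smooth_sprayForm (hD : IsRegularDomain φ D) (v : Coord n) :
    Smooth (OverSet n D) (sprayForm φ v) := by
  have hU := hD.smooth_U.over (n := n) hD.pos
  have hV := hD.smooth_V.over (n := n) hD.pos
  have hW := hD.smooth_W.over (n := n) hD.pos
  have hα : Smooth (OverSet n D) fun _ y => spNorm y := smooth_snd_spNorm
  have hs := smooth_spDot (OverSet n D)
  exact ((((hs.mul hα).mul (hU.add (smooth_zOf.mul hV))).mul (Smooth.const _)).add
    ((hs.mul (hV.add hW)).mul (smooth_snd_spDot _ v))).sub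
    (((ContDiffOn.pow hα 2).mul hW).mul (smooth_fst_spDot _ v))

theorem IsRegularDomain.smooth_spray (hD : IsRegularDomain φ D) (C : Fin (n + 1)) :
    Smooth (OverSet n D) (spray (metricL φ) C) :=
  (hD.smooth_sprayForm (Pi.single C 1)).congr (hD.spray_eq C)

theorem IsRegularDomain.pdSnd_sprayForm (hD : IsRegularDomain φ D) (h : Over D x y)
    (v b : Coord n) {t : ℝ} (ht : t = (b 0 - zOf y * (spDot y b / spNorm y)) / spNorm y) :
    pdSnd b (sprayForm φ v) x y =
      (spDot x b * spNorm y + spDot x y * (spDot y b / spNorm y))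
          * (U φ (zOf y) (spNorm x) + zOf y * V φ (zOf y) (spNorm x)) * v 0
        + spDot x y * spNorm y * (dz (U φ) (zOf y) (spNorm x) + V φ (zOf y) (spNorm x)
          + zOf y * dz (V φ) (zOf y) (spNorm x)) * t * v 0
        + spDot x b * (V φ (zOf y) (spNorm x) + W φ (zOf y) (spNorm x)) * spDot y v
        + spDot x y * (dz (V φ) (zOf y) (spNorm x) + dz (W φ) (zOf y) (spNorm x)) * t * spDot y v
        + spDot x y * (V φ (zOf y) (spNorm x) + W φ (zOf y) (spNorm x)) * spDot b v
        - 2 * spDot y b * W φ (zOf y) (spNorm x) * spDot x v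
        - spNorm y ^ 2 * (dz (W φ) (zOf y) (spNorm x) * t) * spDot x v := by
  have hU := hD.smooth_U.hasPD_over (a := 0) (b := b) hD.isOpen hD.pos h
  have hV := hD.smooth_V.hasPD_over (a := 0) (b := b) hD.isOpen hD.pos h
  have hW := hD.smooth_W.hasPD_over (a := 0) (b := b) hD.isOpen hD.pos h
  have hα := hasPD_snd_spNorm (x := x) (a := 0) (b := b) h.1
  have hz := hasPD_zOf (x := x) (a := 0) (b := b) h.1
  have hs := hasPD_spDot (x := x) (y := y) (a := 0) (b := b)
  rw [← ht] at hU hV hW hz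
  refine (((((hs.mul hα).mul (hU.add (hz.mul hV))).mul (HasPD.const (v 0))).add
    ((hs.mul (hV.add hW)).mul (hasPD_snd_spDot v))).sub
    (((hα.sq).mul hW).mul (hasPD_fst_spDot v))).pdSnd_eq.trans ?_
  have h1 := h.1
  simp only [spDot_zero, zero_spDot]
  field_simp
  ring

/-- The fibre divergence of the spray is `Ψ` times `x^m y^m`. -/
theorem IsRegularDomain.meanBerwald_eq (hD : IsRegularDomain φ D) (x y : Coord n)
    (h : (x, y) ∈ OverSet n D) :
    meanBerwald (spray (metricL φ)) x y = Psi n φ (zOf y) (spNorm x) * spDot x y := by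
  have h' : Over D x y := h
  have hα := h'.1
  have hS := isOpen_overSet (n := n) hD.isOpen
  have h1 : ∀ C : Fin (n + 1), dy C (spray (metricL φ) C) x y
      = pdSnd (Pi.single C 1) (sprayForm φ (Pi.single C 1)) x y := fun C =>
    pdSnd_congr hS (hD.spray_eq C) _ h
  simp only [meanBerwald, h1, hD.pdSnd_sprayForm h' _ _ rfl]
  rw [Fin.sum_univ_succ]
  simp only [Pi.single_eq_same, spDot_single_zero, spDot_single_succ]
  have h2 : ∀ i : Fin n, (Pi.single i.succ 1 : Coord n) 0 = 0 := fun i => by simp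
  simp only [h2]
  generalize hU : dz (U φ) (zOf y) (spNorm x) = Uz
  generalize hV : V φ (zOf y) (spNorm x) = v
  generalize hW : W φ (zOf y) (spNorm x) = w
  generalize dz (V φ) (zOf y) (spNorm x) = vz
  generalize dz (W φ) (zOf y) (spNorm x) = wz
  generalize hs : spDot x y = s
  refine (congrArg₂ (· + ·) rfl (Finset.sum_congr rfl fun i _ =>
    (?_ : _ = (v - w + zOf y * wz) * (x i.succ * y i.succ)
      + (-(s * (vz + wz) * zOf y / spNorm y ^ 2)) * (y i.succ * y i.succ) + s * (v + w)))).trans ?_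
  · field_simp
    ring
  · have e1 : ∑ i : Fin n, x i.succ * y i.succ = s := hs
    have e2 : ∑ i : Fin n, y i.succ * y i.succ = spNorm y ^ 2 := spDot_self y
    simp only [Finset.sum_add_distrib, ← Finset.mul_sum, e1, e2, Finset.sum_const,
      Finset.card_univ, Fintype.card_fin, nsmul_eq_mul, Psi, hU, hV, hW]
    field_simp
    ring

/-- The derivative of `Π = Ψ x^m y^m` along a fibre direction `v`, and its derivatives. -/
theorem IsRegularDomain.pdSnd_meanBerwald (hD : IsRegularDomain φ D) (v x y : Coord n)
    (h : (x, y) ∈ OverSet n D) :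
    pdSnd v (meanBerwald (spray (metricL φ))) x y =
      dz (Psi n φ) (zOf y) (spNorm x) * ((v 0 - zOf y * (spDot y v / spNorm y)) / spNorm y)
        * spDot x y + Psi n φ (zOf y) (spNorm x) * spDot x v := by
  have h' : Over D x y := h
  rw [pdSnd_congr (isOpen_overSet hD.isOpen) hD.meanBerwald_eq v h]
  refine (((hD.smooth_Psi n).hasPD_over hD.isOpen hD.pos h').mul hasPD_spDot).pdSnd_eq.trans ?_
  simp only [spDot_zero, zero_spDot]
  ring

theorem IsRegularDomain.pdFst_meanBerwald (hD : IsRegularDomain φ D) (v x y : Coord n)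
    (h : (x, y) ∈ OverSet n D) :
    pdFst v (meanBerwald (spray (metricL φ))) x y =
      dr (Psi n φ) (zOf y) (spNorm x) * (spDot x v / spNorm x) * spDot x y
        + Psi n φ (zOf y) (spNorm x) * spDot y v := by
  have h' : Over D x y := h
  rw [pdFst_congr (isOpen_overSet hD.isOpen) hD.meanBerwald_eq v h]
  refine (((hD.smooth_Psi n).hasPD_over hD.isOpen hD.pos h').mul hasPD_spDot).pdFst_eq.trans ?_
  simp only [spDot_zero, Pi.zero_apply, spDot_comm v y]
  ring

theorem IsRegularDomain.smooth_meanBerwald (hD : IsRegularDomain φ D) :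
    Smooth (OverSet n D) (meanBerwald (spray (metricL φ))) :=
  (((hD.smooth_Psi n).over hD.pos).mul (smooth_spDot _)).congr hD.meanBerwald_eq

/-- Second derivatives of `Π` with at least one fibre direction; `t`, `τ` are the derivatives of
`z` along `v` and along `b`. -/
theorem IsRegularDomain.hasPD_pdSnd_meanBerwald (hD : IsRegularDomain φ D) (h : Over D x y)
    (v : Coord n) {t τ : ℝ} (ht : t = (v 0 - zOf y * (spDot y v / spNorm y)) / spNorm y)
    (hτ : τ = (b 0 - zOf y * (spDot y b / spNorm y)) / spNorm y) :
    HasPD (fun x y : Coord n =>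
      dz (Psi n φ) (zOf y) (spNorm x) * ((v 0 - zOf y * (spDot y v / spNorm y)) / spNorm y)
        * spDot x y + Psi n φ (zOf y) (spNorm x) * spDot x v) x y a b
      ((dz (dz (Psi n φ)) (zOf y) (spNorm x) * τ
          + dr (dz (Psi n φ)) (zOf y) (spNorm x) * (spDot x a / spNorm x)) * t * spDot x y
        + dz (Psi n φ) (zOf y) (spNorm x) * (((-(τ * (spDot y v / spNorm y)
            + zOf y * ((spDot b v - spDot y v / spNorm y * (spDot y b / spNorm y)) / spNorm y)))
            - t * (spDot y b / spNorm y)) / spNorm y) * spDot x y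
        + dz (Psi n φ) (zOf y) (spNorm x) * t * (spDot a y + spDot x b)
        + (dz (Psi n φ) (zOf y) (spNorm x) * τ
          + dr (Psi n φ) (zOf y) (spNorm x) * (spDot x a / spNorm x)) * spDot x v
        + Psi n φ (zOf y) (spNorm x) * spDot a v) := by
  have h1 := (hD.smooth_Psi n).hasPD_over (a := a) (b := b) hD.isOpen hD.pos h
  have h2 := ((hD.smooth_Psi n).dz hD.isOpen).hasPD_over (a := a) (b := b) hD.isOpen hD.pos h
  have hα := hasPD_snd_spNorm (x := x) (a := a) (b := b) h.1
  have hz := hasPD_zOf (x := x) (a := a) (b := b) h.1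
  have hs := hasPD_spDot (x := x) (y := y) (a := a) (b := b)
  rw [← hτ] at h1 h2 hz
  refine (((h2.mul (((HasPD.const (v 0)).sub (hz.mul ((hasPD_snd_spDot v).div hα h.1))).div
    hα h.1)).mul hs).add (h1.mul (hasPD_fst_spDot v))).val ?_
  rw [← ht]
  ring

/-- The χ-curvature in terms of the derivative `t` of `z` along the coordinate direction. -/
theorem IsRegularDomain.chiCurv_eq (hD : IsRegularDomain φ D) (h : Over D x y)
    (A : Fin (n + 1)) {v : Coord n} (hv : v = Pi.single A 1) {t : ℝ}
    (ht : t = (v 0 - zOf y * (spDot y v / spNorm y)) / spNorm y) :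
    chiCurv (spray (metricL φ)) A x y =
      1 / 2 * (dr (dz (Psi n φ)) (zOf y) (spNorm x) * (spDot x y ^ 2 / spNorm x) * t
        + dz (Psi n φ) (zOf y) (spNorm x) * spNorm y ^ 2 * t
        - 2 * (dz (dz (Psi n φ)) (zOf y) (spNorm x) * U φ (zOf y) (spNorm x) * spDot x y ^ 2 * t
          + dz (Psi n φ) (zOf y) (spNorm x) * (spDot x y
            * (-(U φ (zOf y) (spNorm x) * spDot x y * spDot y v
                - zOf y * W φ (zOf y) (spNorm x) * (spNorm y ^ 2 * spDot x v
                  - spDot x y * spDot y v)) / spNorm y ^ 2)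
            - spNorm y ^ 2 * spNorm x ^ 2 * W φ (zOf y) (spNorm x) * t
            + spDot x y ^ 2 * W φ (zOf y) (spNorm x) * t
            + U φ (zOf y) (spNorm x) * spDot x y * spDot x v))) := by
  have hS := isOpen_overSet (n := n) hD.isOpen
  have hα := h.1
  have hρ : spNorm x ≠ 0 := (hD.pos _ h.2).ne'
  have e1 : ∑ B, dy A (dx B (meanBerwald (spray (metricL φ)))) x y * y B
      = pdFst y (pdSnd v (meanBerwald (spray (metricL φ)))) x y := by
    rw [← sum_pdFst_single_mul, hv]
    exact Finset.sum_congr rfl fun B _ => by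
      rw [hD.smooth_meanBerwald.fst_snd_comm hS h]; rfl
  have e2 : ∑ B, dy B (dy A (meanBerwald (spray (metricL φ)))) x y * spray (metricL φ) B x y
      = pdSnd (sprayVec φ x y) (pdSnd v (meanBerwald (spray (metricL φ)))) x y := by
    rw [← sum_pdSnd_single_mul, hv]
    exact Finset.sum_congr rfl fun B _ => by rw [hD.spray_eq B x y h]; rfl
  rw [chiCurv, e1, e2, dx_eq_pdFst, ← hv, hD.pdFst_meanBerwald v x y h,
    pdFst_congr hS (hD.pdSnd_meanBerwald v) _ h, pdSnd_congr hS (hD.pdSnd_meanBerwald v) _ h,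
    (hD.hasPD_pdSnd_meanBerwald h v ht rfl).pdFst_eq,
    (hD.hasPD_pdSnd_meanBerwald h v ht rfl).pdSnd_eq, zOf_sprayVec φ x y hα,
    spDot_snd_sprayVec, spDot_comm (sprayVec φ x y), spDot_sprayVec, spDot_fst_sprayVec]
  simp only [spDot_zero, zero_spDot, Pi.zero_apply]
  rw [spDot_self]
  field_simp
  ring

end MeanBerwald

section ChiComponents

variable {n : ℕ} {φ : ℝ → ℝ → ℝ} {D : Set (ℝ × ℝ)} {x y : Coord n}

theorem IsRegularDomain.chiCurv_zero (hD : IsRegularDomain φ D) (h : Over D x y) :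
    chiCurv (spray (metricL φ)) 0 x y =
      (1 / (2 * spNorm x) * dr (dz (Psi n φ)) (zOf y) (spNorm x)
          - U φ (zOf y) (spNorm x) * dz (dz (Psi n φ)) (zOf y) (spNorm x)
          - W φ (zOf y) (spNorm x) * dz (Psi n φ) (zOf y) (spNorm x))
          * (spDot x y ^ 2 / spNorm y)
        + 1 / 2 * (2 * spNorm x ^ 2 * W φ (zOf y) (spNorm x) + 1)
          * dz (Psi n φ) (zOf y) (spNorm x) * spNorm y := by
  have hα := h.1
  have hρ : spNorm x ≠ 0 := (hD.pos _ h.2).ne'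
  rw [hD.chiCurv_eq h 0 rfl rfl]
  simp only [spDot_single_zero, Pi.single_eq_same]
  field_simp
  ring

theorem IsRegularDomain.chiCurv_succ (hD : IsRegularDomain φ D) (h : Over D x y) (i : Fin n) :
    chiCurv (spray (metricL φ)) i.succ x y =
      (zOf y * U φ (zOf y) (spNorm x) * dz (dz (Psi n φ)) (zOf y) (spNorm x)
          - zOf y / (2 * spNorm x) * dr (dz (Psi n φ)) (zOf y) (spNorm x)
          + (U φ (zOf y) (spNorm x) + 2 * zOf y * W φ (zOf y) (spNorm x))
            * dz (Psi n φ) (zOf y) (spNorm x)) * (spDot x y ^ 2 / spNorm y ^ 2) * y i.succ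
        - zOf y / 2 * (2 * spNorm x ^ 2 * W φ (zOf y) (spNorm x) + 1)
          * dz (Psi n φ) (zOf y) (spNorm x) * y i.succ
        - (U φ (zOf y) (spNorm x) + zOf y * W φ (zOf y) (spNorm x))
          * dz (Psi n φ) (zOf y) (spNorm x) * spDot x y * x i.succ := by
  have hα := h.1
  have hρ : spNorm x ≠ 0 := (hD.pos _ h.2).ne'
  rw [hD.chiCurv_eq h i.succ rfl rfl]
  have h2 : (Pi.single i.succ 1 : Coord n) 0 = 0 := by simp
  simp only [spDot_single_succ, h2]
  field_simp
  ring

theorem IsRegularDomain.chiCurv_eq_zero (hD : IsRegularDomain φ D)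
    (hΨ : ∀ p ∈ D, dz (Psi n φ) p.1 p.2 = 0) (h : Over D x y) (A : Fin (n + 1)) :
    chiCurv (spray (metricL φ)) A x y = 0 := by
  have h0 : dz (Psi n φ) (zOf y) (spNorm x) = 0 := hΨ _ h.2
  have h1 : dz (dz (Psi n φ)) (zOf y) (spNorm x) = 0 := by
    rw [dz_congr hD.isOpen (g := fun _ _ => 0) (fun z ρ hp => hΨ _ hp) h.2]
    simp [dz]
  have h2 : dr (dz (Psi n φ)) (zOf y) (spNorm x) = 0 := by
    rw [dr_congr hD.isOpen (g := fun _ _ => 0) (fun z ρ hp => hΨ _ hp) h.2]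
    simp [dr]
  rw [hD.chiCurv_eq h A rfl rfl, h0, h1, h2]
  ring

end ChiComponents

/-! ### Ricci tensors of a spray with vanishing χ-curvature -/

section GeneralSpray

variable {n : ℕ} {S : Set (Coord n × Coord n)} {G : Fin (n + 1) → Coord n → Coord n → ℝ}
  {x y : Coord n}

theorem Smooth.dx {f : Coord n → Coord n → ℝ} (hf : Smooth S f) (hS : IsOpen S)
    (A : Fin (n + 1)) : Smooth S (dx A f) := hf.pdFst hS _

theorem Smooth.dy {f : Coord n → Coord n → ℝ} (hf : Smooth S f) (hS : IsOpen S)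
    (A : Fin (n + 1)) : Smooth S (dy A f) := hf.pdSnd hS _

theorem Smooth.hasPD_dy {f : Coord n → Coord n → ℝ} (hf : Smooth S f) (hS : IsOpen S)
    (hp : (x, y) ∈ S) (A : Fin (n + 1)) :
    HasPD f x y 0 (Pi.single A 1) (WarpedFinsler.dy A f x y) := hf.hasPD_snd hS hp _

theorem dy_congr {f g : Coord n → Coord n → ℝ} (hS : IsOpen S)
    (h : ∀ x y, (x, y) ∈ S → f x y = g x y) (A : Fin (n + 1)) (hp : (x, y) ∈ S) :
    dy A f x y = dy A g x y := pdSnd_congr hS h _ hp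

theorem dy_dx_comm {f : Coord n → Coord n → ℝ} (hf : Smooth S f) (hS : IsOpen S)
    (hp : (x, y) ∈ S) (A B : Fin (n + 1)) : dy B (dx A f) x y = dx A (dy B f) x y :=
  (hf.fst_snd_comm hS hp _ _).symm

theorem dy_dy_comm {f : Coord n → Coord n → ℝ} (hf : Smooth S f) (hS : IsOpen S)
    (hp : (x, y) ∈ S) (A B : Fin (n + 1)) : dy B (dy A f) x y = dy A (dy B f) x y :=
  hf.snd_snd_comm hS hp _ _

theorem dx_meanBerwald (hS : IsOpen S) (hG : ∀ C, Smooth S (G C)) (hp : (x, y) ∈ S)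
    (A : Fin (n + 1)) : dx A (meanBerwald G) x y = ∑ C, dx A (dy C (G C)) x y :=
  (HasPD.sum fun C _ => (((hG C).dy hS C).hasPD_fst hS hp _)).pdFst_eq

theorem dy_meanBerwald (hS : IsOpen S) (hG : ∀ C, Smooth S (G C)) (hp : (x, y) ∈ S)
    (A : Fin (n + 1)) : dy A (meanBerwald G) x y = ∑ C, dy A (dy C (G C)) x y :=
  (HasPD.sum fun C _ => (((hG C).dy hS C).hasPD_dy hS hp A)).pdSnd_eq

theorem dy_dx_meanBerwald (hS : IsOpen S) (hG : ∀ C, Smooth S (G C)) (hp : (x, y) ∈ S)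
    (A B : Fin (n + 1)) :
    dy B (dx A (meanBerwald G)) x y = ∑ C, dy C (dy B (dx A (G C))) x y := by
  rw [dy_congr hS (fun x y hp => dx_meanBerwald hS hG hp A) B hp]
  refine (HasPD.sum fun C _ =>
    ((((hG C).dy hS C).dx hS A).hasPD_dy hS hp B)).pdSnd_eq.trans ?_
  refine Finset.sum_congr rfl fun C _ => ?_
  rw [dy_dy_comm ((hG C).dx hS A) hS hp B C]
  exact dy_congr hS (fun x y hp => (dy_dx_comm (hG C) hS hp A C).symm) B hp

theorem dy_dy_meanBerwald (hS : IsOpen S) (hG : ∀ C, Smooth S (G C)) (hp : (x, y) ∈ S)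
    (A B : Fin (n + 1)) :
    dy B (dy A (meanBerwald G)) x y = ∑ C, dy C (dy B (dy A (G C))) x y := by
  rw [dy_congr hS (fun x y hp => dy_meanBerwald hS hG hp A) B hp]
  refine (HasPD.sum fun C _ =>
    ((((hG C).dy hS C).dy hS A).hasPD_dy hS hp B)).pdSnd_eq.trans ?_
  refine Finset.sum_congr rfl fun C _ => ?_
  rw [dy_dy_comm ((hG C).dy hS A) hS hp B C]
  exact dy_congr hS (fun x y hp => (dy_dy_comm (hG C) hS hp A C).symm) B hp

theorem ricci_eq (hS : IsOpen S) (hG : ∀ C, Smooth S (G C)) (x y : Coord n) (hp : (x, y) ∈ S) :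
    ricci G x y = 2 * (∑ A, dx A (G A) x y) - (∑ A, dx A (meanBerwald G) x y * y A)
      + 2 * (∑ A, G A x y * dy A (meanBerwald G) x y)
      - ∑ C, ∑ A, dy A (G C) x y * dy C (G A) x y := by
  have h1 : ∑ A, dx A (meanBerwald G) x y * y A
      = ∑ C, ∑ A, dy C (dx A (G C)) x y * y A := by
    rw [Finset.sum_comm]
    refine Finset.sum_congr rfl fun A _ => ?_
    rw [dx_meanBerwald hS hG hp, Finset.sum_mul]
    exact Finset.sum_congr rfl fun C _ => by rw [dy_dx_comm (hG C) hS hp]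
  have h2 : ∑ A, G A x y * dy A (meanBerwald G) x y
      = ∑ C, ∑ A, G A x y * dy C (dy A (G C)) x y := by
    rw [Finset.sum_comm]
    refine Finset.sum_congr rfl fun A _ => ?_
    rw [dy_meanBerwald hS hG hp, Finset.mul_sum]
    exact Finset.sum_congr rfl fun C _ => by rw [dy_dy_comm (hG C) hS hp]
  rw [h1, h2]
  simp only [ricci, flagCurv, Finset.sum_add_distrib, Finset.sum_sub_distrib, ← Finset.mul_sum]

/-- The fibre divergence of the flag curvature is governed by the Ricci curvature and the
χ-curvature. -/
theorem sum_dy_flagCurv (hS : IsOpen S) (hG : ∀ C, Smooth S (G C)) (hp : (x, y) ∈ S)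
    (B : Fin (n + 1)) :
    2 * (∑ C, dy C (flagCurv G C B) x y) + dy B (ricci G) x y = -6 * chiCurv G B x y := by
  have hP : Smooth S (meanBerwald G) := Smooth.sum fun C _ => (hG C).dy hS C
  have hK : ∀ C, dy C (flagCurv G C B) x y = _ := fun C =>
    ((((HasPD.const_mul 2 (((hG C).dx hS B).hasPD_dy hS hp C)).sub
      (HasPD.sum fun A _ => ((((hG C).dx hS A).dy hS B).hasPD_dy hS hp C).mul
        (hasPD_snd_apply A))).add
      (HasPD.const_mul 2 (HasPD.sum fun A _ => ((hG A).hasPD_dy hS hp C).mul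
        ((((hG C).dy hS A).dy hS B).hasPD_dy hS hp C)))).sub
      (HasPD.sum fun A _ => (((hG C).dy hS A).hasPD_dy hS hp C).mul
        (((hG A).dy hS B).hasPD_dy hS hp C))).pdSnd_eq
  have hR : dy B (ricci G) x y = _ := (dy_congr hS (ricci_eq hS hG) B hp).trans
    ((((HasPD.const_mul 2 (HasPD.sum fun A _ => ((hG A).dx hS A).hasPD_dy hS hp B)).sub
      (HasPD.sum fun A _ => ((hP.dx hS A).hasPD_dy hS hp B).mul (hasPD_snd_apply A))).add
      (HasPD.const_mul 2 (HasPD.sum fun A _ => ((hG A).hasPD_dy hS hp B).mul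
        ((hP.dy hS A).hasPD_dy hS hp B)))).sub
      (HasPD.sum fun C _ => HasPD.sum fun A _ => (((hG C).dy hS A).hasPD_dy hS hp B).mul
        (((hG A).dy hS C).hasPD_dy hS hp B))).pdSnd_eq
  have s1 : ∑ C, dy C (dx B (G C)) x y = dx B (meanBerwald G) x y := by
    rw [dx_meanBerwald hS hG hp]
    exact Finset.sum_congr rfl fun C _ => dy_dx_comm (hG C) hS hp _ _
  have s2 : ∑ C, ∑ A, dy C (dy B (dx A (G C))) x y * y A
      = ∑ A, dy B (dx A (meanBerwald G)) x y * y A := by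
    rw [Finset.sum_comm]
    refine Finset.sum_congr rfl fun A _ => ?_
    rw [dy_dx_meanBerwald hS hG hp, Finset.sum_mul]
  have s3 : ∑ C, ∑ A, dy B (dx A (G C)) x y * (Pi.single C 1 : Coord n) A
      = ∑ C, dy B (dx C (G C)) x y := by
    simp [Pi.single_apply]
  have s5 : ∑ C, ∑ A, G A x y * dy C (dy B (dy A (G C))) x y
      = ∑ A, G A x y * dy B (dy A (meanBerwald G)) x y := by
    rw [Finset.sum_comm]
    refine Finset.sum_congr rfl fun A _ => ?_
    rw [dy_dy_meanBerwald hS hG hp, Finset.mul_sum]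
  have s6 : ∑ C, ∑ A, dy C (dy A (G C)) x y * dy B (G A) x y
      = ∑ A, dy B (G A) x y * dy A (meanBerwald G) x y := by
    rw [Finset.sum_comm]
    refine Finset.sum_congr rfl fun A _ => ?_
    rw [dy_meanBerwald hS hG hp, Finset.mul_sum]
    exact Finset.sum_congr rfl fun C _ => by rw [dy_dy_comm (hG C) hS hp, mul_comm]
  have s7 : ∑ C, ∑ A, dy A (G C) x y * dy C (dy B (G A)) x y
      = ∑ C, ∑ A, dy C (G A) x y * dy B (dy A (G C)) x y := by
    rw [Finset.sum_comm]
    refine Finset.sum_congr rfl fun A _ => Finset.sum_congr rfl fun C _ => ?_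
    rw [dy_dy_comm (hG A) hS hp]
  have s8 : ∑ C, ∑ A, dy B (dy A (G C)) x y * dy C (G A) x y
      = ∑ C, ∑ A, dy C (G A) x y * dy B (dy A (G C)) x y := by
    simp only [mul_comm]
  have s9 : ∑ C, ∑ A, dy A (G C) x y * dy B (dy C (G A)) x y
      = ∑ C, ∑ A, dy C (G A) x y * dy B (dy A (G C)) x y := Finset.sum_comm
  have s10 : ∑ A, dx A (meanBerwald G) x y * (Pi.single B 1 : Coord n) A
      = dx B (meanBerwald G) x y := by
    simp [Pi.single_apply]
  have s11 : ∑ A, dy A (dy B (meanBerwald G)) x y * G A x y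
      = ∑ A, G A x y * dy B (dy A (meanBerwald G)) x y :=
    Finset.sum_congr rfl fun A _ => by rw [dy_dy_comm hP hS hp, mul_comm]
  simp only [hK, hR, chiCurv, Finset.sum_add_distrib, Finset.sum_sub_distrib, ← Finset.mul_sum,
    s1, s2, s3, s5, s6, s7, s8, s9, s10, s11]
  ring

/-- A spray with vanishing Ricci curvature and vanishing χ-curvature is strongly Ricci-flat. -/
theorem ricciAZ_eq_zero (hS : IsOpen S) (hRic : ∀ x y, (x, y) ∈ S → ricci G x y = 0)
    (hp : (x, y) ∈ S) (A B : Fin (n + 1)) : ricciAZ G A B x y = 0 := by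
  have h1 : ∀ x y, (x, y) ∈ S → dy A (ricci G) x y = (fun _ _ => (0 : ℝ)) x y := fun x y hp => by
    rw [dy_congr hS (g := fun _ _ => 0) hRic A hp]
    simp [dy]
  rw [ricciAZ, dy_congr hS h1 B hp]
  simp [dy]

theorem smooth_flagCurv (hS : IsOpen S) (hG : ∀ C, Smooth S (G C)) (C B : Fin (n + 1)) :
    Smooth S (flagCurv G C B) :=
  ((((Smooth.const 2).mul ((hG C).dx hS B)).sub (Smooth.sum fun A _ =>
    (((hG C).dx hS A).dy hS B).mul (smooth_snd_apply S A))).add ((Smooth.const 2).mul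
    (Smooth.sum fun A _ => (hG A).mul (((hG C).dy hS A).dy hS B)))).sub
    (Smooth.sum fun A _ => ((hG C).dy hS A).mul ((hG A).dy hS B))

theorem sum_riemannBerwald_eq_zero (hS : IsOpen S) (hG : ∀ C, Smooth S (G C))
    (hRic : ∀ x y, (x, y) ∈ S → ricci G x y = 0)
    (hχ : ∀ x y, (x, y) ∈ S → ∀ A, chiCurv G A x y = 0) (hp : (x, y) ∈ S) (A B : Fin (n + 1)) :
    ∑ C, riemannBerwald G A C C B x y = 0 := by
  have hK := fun C B => smooth_flagCurv hS hG C B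
  have dRic : ∀ x y, (x, y) ∈ S → ∀ B, dy B (ricci G) x y = 0 := fun x y hp B => by
    rw [dy_congr hS (g := fun _ _ => 0) hRic B hp]
    simp [dy]
  have hR : ∀ x y, (x, y) ∈ S → ∑ C, dy B (flagCurv G C C) x y = 0 := fun x y hp => by
    rw [← dRic x y hp B]
    exact (HasPD.sum fun C _ => (hK C C).hasPD_dy hS hp B).pdSnd_eq.symm
  have hT : ∀ x y, (x, y) ∈ S → ∑ C, dy C (flagCurv G C B) x y = 0 := fun x y hp => by
    have := sum_dy_flagCurv hS hG hp B
    rw [dRic x y hp B, hχ x y hp B] at this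
    linarith
  have e1 : ∑ C, dy A (dy B (flagCurv G C C)) x y = 0 := by
    have := dy_congr hS (g := fun _ _ => 0) hR A hp
    rw [← (HasPD.sum fun C _ => ((hK C C).dy hS B).hasPD_dy hS hp A).pdSnd_eq]
    refine this.trans ?_
    simp [dy]
  have e2 : ∑ C, dy A (dy C (flagCurv G C B)) x y = 0 := by
    have := dy_congr hS (g := fun _ _ => 0) hT A hp
    rw [← (HasPD.sum fun C _ => ((hK C B).dy hS C).hasPD_dy hS hp A).pdSnd_eq]
    refine this.trans ?_
    simp [dy]
  simp only [riemannBerwald, ← Finset.mul_sum, Finset.sum_sub_distrib, e1, e2]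
  ring

theorem ricciLS_eq_zero (hS : IsOpen S) (hG : ∀ C, Smooth S (G C))
    (hRic : ∀ x y, (x, y) ∈ S → ricci G x y = 0)
    (hχ : ∀ x y, (x, y) ∈ S → ∀ A, chiCurv G A x y = 0) (hp : (x, y) ∈ S) (A B : Fin (n + 1)) :
    ricciLS G A B x y = 0 := by
  rw [ricciLS, sum_riemannBerwald_eq_zero hS hG hRic hχ hp,
    sum_riemannBerwald_eq_zero hS hG hRic hχ hp]
  ring

end GeneralSpray

/-! ### Sprays that are quadratic on the fibres -/

section Quadratic

variable {n : ℕ} {φ : ℝ → ℝ → ℝ} {D : Set (ℝ × ℝ)} {p q r : ℝ → ℝ} {x y a b : Coord n}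

/-- The spray of the metric is quadratic in `y`, with coefficients that depend on `ρ` only:
`G⁰ = p s y⁰`, `Gⁱ = q s yⁱ - (r (y⁰)² + q α² / 2) xⁱ`, where `s = x^m y^m`. -/
structure HasQuadraticSpray (φ : ℝ → ℝ → ℝ) (D : Set (ℝ × ℝ)) (p q r : ℝ → ℝ) : Prop where
  U_eq : ∀ z ρ, (z, ρ) ∈ D → U φ z ρ = z * (p ρ - q ρ / 2 + r ρ * z ^ 2)
  V_eq : ∀ z ρ, (z, ρ) ∈ D → V φ z ρ = q ρ / 2 - r ρ * z ^ 2
  W_eq : ∀ z ρ, (z, ρ) ∈ D → W φ z ρ = q ρ / 2 + r ρ * z ^ 2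

/-- `G^A v_A` for a quadratic spray. -/
def quadForm (p q r : ℝ → ℝ) (v x y : Coord n) : ℝ :=
  p (spNorm x) * (spDot x y * (y 0 * v 0)) + q (spNorm x) * (spDot x y * spDot y v)
    - (r (spNorm x) * y 0 ^ 2 + q (spNorm x) / 2 * spNorm y ^ 2) * spDot x v

theorem HasQuadraticSpray.Psi_eq (hQ : HasQuadraticSpray φ D p q r) (hD : IsRegularDomain φ D)
    (n : ℕ) (z ρ : ℝ) (h : (z, ρ) ∈ D) : Psi n φ z ρ = p ρ + n * q ρ := by
  have h1 : dz (U φ) z ρ = p ρ - q ρ / 2 + 3 * r ρ * z ^ 2 := by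
    rw [dz_congr hD.isOpen hQ.U_eq h]
    have := (hasDerivAt_id z).mul
      ((((hasDerivAt_id z).pow 2).const_mul (r ρ)).const_add (p ρ - q ρ / 2))
    refine this.deriv.trans ?_
    simp
    ring
  rw [Psi, h1, hQ.V_eq z ρ h, hQ.W_eq z ρ h]
  ring

theorem HasQuadraticSpray.dz_Psi (hQ : HasQuadraticSpray φ D p q r) (hD : IsRegularDomain φ D)
    (n : ℕ) : ∀ t ∈ D, dz (Psi n φ) t.1 t.2 = 0 := fun t ht => by
  rw [dz_congr hD.isOpen (hQ.Psi_eq hD n) ht]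
  simp [dz]

theorem HasQuadraticSpray.sprayForm_eq (hQ : HasQuadraticSpray φ D p q r) (v x y : Coord n)
    (h : (x, y) ∈ OverSet n D) : sprayForm φ v x y = quadForm p q r v x y := by
  have hα : spNorm y ≠ 0 := h.1
  have hz : y 0 = zOf y * spNorm y := by rw [zOf]; field_simp
  rw [sprayForm, quadForm, hQ.U_eq _ _ h.2, hQ.V_eq _ _ h.2, hQ.W_eq _ _ h.2, hz]
  ring

theorem hasPD_quadForm {p' q' r' : ℝ} (hy : spNorm y ≠ 0) (hx : spNorm x ≠ 0)
    (hp : HasDerivAt p p' (spNorm x)) (hq : HasDerivAt q q' (spNorm x))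
    (hr : HasDerivAt r r' (spNorm x)) (v : Coord n) {t : ℝ} (ht : t = spDot x a / spNorm x) :
    HasPD (quadForm p q r v) x y a b
      (p' * t * spDot x y * y 0 * v 0 + p (spNorm x) * (spDot a y + spDot x b) * y 0 * v 0
        + p (spNorm x) * spDot x y * b 0 * v 0
        + q' * t * spDot x y * spDot y v + q (spNorm x) * (spDot a y + spDot x b) * spDot y v
        + q (spNorm x) * spDot x y * spDot b v
        - (r' * t * y 0 ^ 2 + 2 * r (spNorm x) * y 0 * b 0 + q' / 2 * t * spNorm y ^ 2
          + q (spNorm x) * spDot y b) * spDot x v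
        - (r (spNorm x) * y 0 ^ 2 + q (spNorm x) / 2 * spNorm y ^ 2) * spDot a v) := by
  have hρ := hasPD_fst_spNorm (y := y) (a := a) (b := b) hx
  have hα := hasPD_snd_spNorm (x := x) (a := a) (b := b) hy
  have hs := hasPD_spDot (x := x) (y := y) (a := a) (b := b)
  have h0 := hasPD_snd_apply (x := x) (y := y) (a := a) (b := b) 0
  have hp' := hρ.comp hp
  have hq' := hρ.comp hq
  have hr' := hρ.comp hr
  rw [← ht] at hp' hq' hr'
  refine (((hp'.mul (hs.mul (h0.mul (HasPD.const (v 0))))).add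
    (hq'.mul (hs.mul (hasPD_snd_spDot v)))).sub
    (((hr'.mul h0.sq).add ((hq'.div (HasPD.const 2) two_ne_zero).mul hα.sq)).mul
      (hasPD_fst_spDot v))).val ?_
  field_simp
  ring

/-- The trace of the square of the nonlinear connection `[G^C]_{y^A}` of a quadratic spray. -/
theorem sum_sq_pdSnd_quadForm {p' q' r' : ℝ} (hy : spNorm y ≠ 0) (hx : spNorm x ≠ 0)
    (hp : HasDerivAt p p' (spNorm x)) (hq : HasDerivAt q q' (spNorm x))
    (hr : HasDerivAt r r' (spNorm x)) :
    ∑ C, ∑ A, pdSnd (Pi.single A 1) (quadForm p q r (Pi.single C 1)) x y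
        * pdSnd (Pi.single C 1) (quadForm p q r (Pi.single A 1)) x y
      = (p (spNorm x) * spDot x y) ^ 2
        - 4 * p (spNorm x) * r (spNorm x) * y 0 ^ 2 * spNorm x ^ 2
        + q (spNorm x) ^ 2 * ((n + 2) * spDot x y ^ 2 - 2 * spNorm x ^ 2 * spNorm y ^ 2) := by
  have e1 : ∑ i : Fin n, x i.succ * y i.succ = spDot x y := rfl
  have e2 : ∑ i : Fin n, y i.succ * y i.succ = spNorm y ^ 2 := spDot_self y
  have e3 : ∑ i : Fin n, x i.succ * x i.succ = spNorm x ^ 2 := spDot_self x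
  have hN : ∀ v b : Coord n, pdSnd b (quadForm p q r v) x y
      = p (spNorm x) * spDot x b * y 0 * v 0 + p (spNorm x) * spDot x y * b 0 * v 0
        + q (spNorm x) * spDot x b * spDot y v + q (spNorm x) * spDot x y * spDot b v
        - (2 * r (spNorm x) * y 0 * b 0 + q (spNorm x) * spDot y b) * spDot x v := fun v b => by
    rw [(hasPD_quadForm hy hx hp hq hr v rfl).pdSnd_eq]
    simp only [spDot_zero, zero_spDot]
    ring
  generalize hP : p (spNorm x) = P at *
  generalize hQ : q (spNorm x) = Q at *
  generalize hR : r (spNorm x) = R at *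
  generalize hs : spDot x y = s at *
  have h0 : ∀ i : Fin n, (Pi.single i.succ 1 : Coord n) 0 = 0 := fun i => by simp
  have h00 : ∀ i : Fin n, (Pi.single 0 1 : Coord n) i.succ = 0 := fun i => by simp
  have hij : ∀ i j : Fin n,
      pdSnd (Pi.single j.succ 1) (quadForm p q r (Pi.single i.succ 1)) x y
        * pdSnd (Pi.single i.succ 1) (quadForm p q r (Pi.single j.succ 1)) x y
      = (-Q ^ 2 * (y i.succ * y i.succ)) * (x j.succ * x j.succ)
        + (2 * Q ^ 2 * (x i.succ * y i.succ)) * (x j.succ * y j.succ)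
        + (-Q ^ 2 * (x i.succ * x i.succ)) * (y j.succ * y j.succ)
        + (if i = j then Q ^ 2 * s ^ 2 else 0) := fun i j => by
    rw [hN, hN]
    simp only [spDot_single_succ, h0, Pi.single_apply, Fin.succ_inj]
    by_cases hc : i = j
    · subst hc
      simp only [if_true]
      ring
    · have hc' : j ≠ i := fun h => hc h.symm
      simp only [if_neg hc, if_neg hc']
      ring
  have h0j : ∀ j : Fin n,
      pdSnd (Pi.single j.succ 1) (quadForm p q r (Pi.single 0 1)) x y
        * pdSnd (Pi.single 0 1) (quadForm p q r (Pi.single j.succ 1)) x y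
      = (-2 * P * R * y 0 ^ 2) * (x j.succ * x j.succ) := fun j => by
    rw [hN, hN]
    simp only [spDot_single_succ, spDot_single_zero, h0, h00, Pi.single_eq_same]
    ring
  have hi0 : ∀ j : Fin n,
      pdSnd (Pi.single 0 1) (quadForm p q r (Pi.single j.succ 1)) x y
        * pdSnd (Pi.single j.succ 1) (quadForm p q r (Pi.single 0 1)) x y
      = (-2 * P * R * y 0 ^ 2) * (x j.succ * x j.succ) := fun j => by rw [mul_comm, h0j]
  have hzz : pdSnd (Pi.single 0 1) (quadForm p q r (Pi.single 0 1)) x y = P * s := by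
    rw [hN]
    simp only [spDot_single_zero, Pi.single_eq_same]
    ring
  rw [Fin.sum_univ_succ, Fin.sum_univ_succ]
  simp only [Fin.sum_univ_succ (fun A => pdSnd (Pi.single A 1) (quadForm p q r _) x y * _),
    hij, h0j, hi0, hzz, Finset.sum_add_distrib, ← Finset.mul_sum, Finset.sum_ite_eq,
    Finset.mem_univ, if_true, e1, e2, e3, ← Finset.sum_mul, Finset.sum_const, Finset.card_univ,
    Fintype.card_fin, nsmul_eq_mul]
  ring

theorem HasQuadraticSpray.ricci_eq (hQ : HasQuadraticSpray φ D p q r)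
    (hD : IsRegularDomain φ D) {p' q' r' : ℝ} (h : Over D x y)
    (hp : HasDerivAt p p' (spNorm x)) (hq : HasDerivAt q q' (spNorm x))
    (hr : HasDerivAt r r' (spNorm x)) :
    ricci (spray (metricL φ)) x y =
      -2 * y 0 ^ 2 * (spNorm x * r' + n * r (spNorm x)
          + spNorm x ^ 2 * r (spNorm x) * (n * q (spNorm x) - p (spNorm x)))
        + spNorm y ^ 2 * (2 * q (spNorm x) - spNorm x * q' - n * q (spNorm x)
          - (p (spNorm x) + n * q (spNorm x)) * (1 + spNorm x ^ 2 * q (spNorm x))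
          + 2 * spNorm x ^ 2 * q (spNorm x) ^ 2)
        + spDot x y ^ 2 / spNorm x * (2 * q' - (p' + n * q')
          + spNorm x * (2 * (p (spNorm x) + n * q (spNorm x)) * q (spNorm x) - p (spNorm x) ^ 2
            - (n + 2) * q (spNorm x) ^ 2)) := by
  have hS := isOpen_overSet (n := n) hD.isOpen
  have hy := h.1
  have hx : spNorm x ≠ 0 := (hD.pos _ h.2).ne'
  have e1 : ∑ i : Fin n, x i.succ * y i.succ = spDot x y := rfl
  have e2 : ∑ i : Fin n, y i.succ * y i.succ = spNorm y ^ 2 := spDot_self y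
  have e3 : ∑ i : Fin n, x i.succ * x i.succ = spNorm x ^ 2 := spDot_self x
  have hG : ∀ C : Fin (n + 1), ∀ x y, (x, y) ∈ OverSet n D →
      spray (metricL φ) C x y = quadForm p q r (Pi.single C 1) x y := fun C x y hxy => by
    rw [hD.spray_eq C x y hxy, hQ.sprayForm_eq _ x y hxy]
  have hdrΨ : dr (Psi n φ) (zOf y) (spNorm x) = p' + n * q' := by
    rw [dr_congr hD.isOpen (hQ.Psi_eq hD n) h.2]
    exact (hp.add (hq.const_mul (n : ℝ))).deriv
  have hdzΨ : dz (Psi n φ) (zOf y) (spNorm x) = 0 := hQ.dz_Psi hD n _ h.2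
  have t1 : ∑ A, dx A (spray (metricL φ) A) x y
      = q' * spDot x y ^ 2 / spNorm x + q (spNorm x) * spNorm y ^ 2
        - spNorm x * (r' * y 0 ^ 2 + q' / 2 * spNorm y ^ 2)
        - n * (r (spNorm x) * y 0 ^ 2 + q (spNorm x) / 2 * spNorm y ^ 2) := by
    have hA : ∀ A : Fin (n + 1), dx A (spray (metricL φ) A) x y = _ := fun A =>
      (pdFst_congr hS (hG A) _ h).trans (hasPD_quadForm hy hx hp hq hr _ rfl).pdFst_eq
    simp only [hA]
    rw [Fin.sum_univ_succ]
    have h0 : ∀ i : Fin n, (Pi.single i.succ 1 : Coord n) 0 = 0 := fun i => by simp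
    simp only [spDot_single_zero, spDot_single_succ, h0, spDot_zero, Pi.zero_apply,
      Pi.single_eq_same, spDot_comm (Pi.single _ 1) y]
    refine (congrArg₂ (· + ·) rfl (Finset.sum_congr rfl fun i _ =>
      (?_ : _ = (q' * spDot x y / spNorm x) * (x i.succ * y i.succ)
        + q (spNorm x) * (y i.succ * y i.succ)
        + (-(r' * y 0 ^ 2 + q' / 2 * spNorm y ^ 2) / spNorm x) * (x i.succ * x i.succ)
        + (-(r (spNorm x) * y 0 ^ 2 + q (spNorm x) / 2 * spNorm y ^ 2))))).trans ?_
    · field_simp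
      ring
    · simp only [Finset.sum_add_distrib, ← Finset.mul_sum, e1, e2, e3, Finset.sum_const,
        Finset.card_univ, Fintype.card_fin, nsmul_eq_mul]
      field_simp
      ring
  have t2 : ∑ A, dx A (meanBerwald (spray (metricL φ))) x y * y A
      = (p' + n * q') * spDot x y ^ 2 / spNorm x
        + (p (spNorm x) + n * q (spNorm x)) * spNorm y ^ 2 := by
    rw [← spDot_self]
    refine (sum_pdFst_single_mul _ x y y).trans ?_
    rw [hD.pdFst_meanBerwald y x y h, hdrΨ, hQ.Psi_eq hD n _ _ h.2]
    ring
  have t3 : ∑ A, spray (metricL φ) A x y * dy A (meanBerwald (spray (metricL φ))) x y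
      = (p (spNorm x) + n * q (spNorm x)) * (q (spNorm x) * spDot x y ^ 2
        - spNorm x ^ 2 * (r (spNorm x) * y 0 ^ 2 + q (spNorm x) / 2 * spNorm y ^ 2)) := by
    have : ∑ A, spray (metricL φ) A x y * dy A (meanBerwald (spray (metricL φ))) x y
        = ∑ A, pdSnd (Pi.single A 1) (meanBerwald (spray (metricL φ))) x y
          * sprayVec φ x y A :=
      Finset.sum_congr rfl fun A _ => by rw [hD.spray_eq A x y h, mul_comm]; rfl
    have hz : y 0 = zOf y * spNorm y := by rw [zOf]; field_simp
    rw [this, sum_pdSnd_single_mul, hD.pdSnd_meanBerwald _ x y h, hdzΨ, hQ.Psi_eq hD n _ _ h.2,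
      spDot_fst_sprayVec, hQ.V_eq _ _ h.2, hQ.W_eq _ _ h.2, hz]
    ring
  have t4 : ∑ C, ∑ A, dy A (spray (metricL φ) C) x y * dy C (spray (metricL φ) A) x y = _ :=
    (Finset.sum_congr rfl fun C _ => Finset.sum_congr rfl fun A _ => by
      rw [dy_congr hS (hG C) A h, dy_congr hS (hG A) C h]; rfl).trans
    (sum_sq_pdSnd_quadForm hy hx hp hq hr)
  rw [WarpedFinsler.ricci_eq hS hD.smooth_spray x y h, t1, t2, t3, t4]
  field_simp
  ring

end Quadratic

section Flat

variable {n : ℕ} {φ : ℝ → ℝ → ℝ} {D : Set (ℝ × ℝ)} {p q r : ℝ → ℝ} {I : Set ℝ}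

/-- The differential equations on `p` and `q` under which the spray `G⁰ = p s y⁰`,
`Gⁱ = q s yⁱ - (r (y⁰)² + q α² / 2) xⁱ` is Ricci-flat, for a suitable `r`. The last two equations
are the coefficients of `α²` and of `s² / ρ` in `Ric`; these monomials are proportional if
`n = 1`, and the coefficient of `α²` that results then vanishes by the first equation. -/
def FlatCoeffs (n : ℕ) (I : Set ℝ) (p q : ℝ → ℝ) : Prop :=
  ∀ ρ ∈ I, ∃ p' q' : ℝ, HasDerivAt p p' ρ ∧ HasDerivAt q q' ρ ∧
    ρ * p' + p ρ * (n + ρ ^ 2 * p ρ + (n - 2) * (ρ ^ 2 * q ρ)) = 0 ∧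
    (n = 1 ∨
      (2 * q ρ - ρ * q' - n * q ρ - (p ρ + n * q ρ) * (1 + ρ ^ 2 * q ρ)
          + 2 * ρ ^ 2 * q ρ ^ 2 = 0 ∧
        2 * q' - (p' + n * q') + ρ * (2 * (p ρ + n * q ρ) * q ρ - p ρ ^ 2
          - (n + 2) * q ρ ^ 2) = 0))

theorem HasQuadraticSpray.ricci_eq_zero (hQ : HasQuadraticSpray φ D p q r)
    (hD : IsRegularDomain φ D) (hF : FlatCoeffs n (Prod.snd '' D) p q)
    (hr : ∀ ρ ∈ Prod.snd '' D,
      HasDerivAt r (-(n * r ρ + ρ ^ 2 * r ρ * (n * q ρ - p ρ)) / ρ) ρ)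
    (x y : Coord n) (h : (x, y) ∈ OverSet n D) : ricci (spray (metricL φ)) x y = 0 := by
  have hρ : spNorm x ∈ Prod.snd '' D := ⟨_, h.2, rfl⟩
  have hx : spNorm x ≠ 0 := (hD.pos _ h.2).ne'
  obtain ⟨p', q', hp, hq, h0, h12⟩ := hF _ hρ
  rw [hQ.ricci_eq hD h hp hq (hr _ hρ)]
  have e0 : spNorm x * (-(n * r (spNorm x) + spNorm x ^ 2 * r (spNorm x)
      * (n * q (spNorm x) - p (spNorm x))) / spNorm x) + n * r (spNorm x)
      + spNorm x ^ 2 * r (spNorm x) * (n * q (spNorm x) - p (spNorm x)) = 0 := by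
    field_simp
    ring
  rw [e0]
  rcases h12 with h1 | ⟨h1, h2⟩
  · subst h1
    have hs : spDot x y ^ 2 = spNorm x ^ 2 * spNorm y ^ 2 := by
      rw [← spDot_self, ← spDot_self]
      simp [spDot]
      ring
    rw [hs]
    push_cast at h0 ⊢
    field_simp
    linear_combination (-spNorm y ^ 2) * h0
  · rw [h1, h2]
    ring

/-- `Ψ_z = 0` on `D`, and the Ricci curvature and both Ricci tensors of `L = α² φ` vanish
over `D`. -/
def StronglyRicciFlat (n : ℕ) (φ : ℝ → ℝ → ℝ) (D : Set (ℝ × ℝ)) : Prop :=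
  (∀ p ∈ D, dz (Psi n φ) p.1 p.2 = 0) ∧
    ∀ x y : Coord n, Over D x y →
      ricci (spray (metricL φ)) x y = 0 ∧
      ∀ A B : Fin (n + 1),
        ricciAZ (spray (metricL φ)) A B x y = 0 ∧
        ricciLS (spray (metricL φ)) A B x y = 0

/-- A metric whose spray is quadratic and satisfies the equations of `FlatCoeffs` is strongly
Ricci-flat. -/
theorem HasQuadraticSpray.stronglyRicciFlat (hQ : HasQuadraticSpray φ D p q r)
    (hD : IsRegularDomain φ D) (hF : FlatCoeffs n (Prod.snd '' D) p q)
    (hr : ∀ ρ ∈ Prod.snd '' D,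
      HasDerivAt r (-(n * r ρ + ρ ^ 2 * r ρ * (n * q ρ - p ρ)) / ρ) ρ) :
    StronglyRicciFlat n φ D := by
  have hΨ := hQ.dz_Psi hD n
  have hRic := hQ.ricci_eq_zero hD hF hr
  have hS := isOpen_overSet (n := n) hD.isOpen
  refine ⟨hΨ, fun x y h => ⟨hRic x y h, fun A B => ⟨ricciAZ_eq_zero hS hRic h A B, ?_⟩⟩⟩
  exact ricciLS_eq_zero hS hD.smooth_spray hRic
    (fun x y hxy A => hD.chiCurv_eq_zero hΨ hxy A) h A B

theorem isOpen_image_snd (hD : IsRegularDomain φ D) : IsOpen (Prod.snd '' D) :=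
  isOpenMap_snd _ hD.isOpen

/-! ### Metrics `φ(z, ρ) = H(z, h(ρ))` with `H` homogeneous of degree two -/

/-- If `φ_ρ = ρ q Ω` with `q` a function of `ρ`, then the spray is quadratic. By Euler's theorem
this equation says that `φ(z, ρ) = H(z, h(ρ))` with `H` homogeneous of degree two and
`h' = ρ q h`, so that `L` is a function of `y⁰` and of the norm of the conformally flat metric
`h² |dx̄|²`. -/
theorem hasQuadraticSpray_of_dr_eq (hD : IsRegularDomain φ D)
    (h : ∀ z ρ, (z, ρ) ∈ D → dr φ z ρ = ρ * q ρ * Om φ z ρ) :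
    HasQuadraticSpray φ D (fun _ => 0) q (fun _ => 0) := by
  have hs : Smooth D φ := hD.smooth
  have h2 : ∀ z ρ, (z, ρ) ∈ D → dr (dz φ) z ρ
      = ρ * q ρ * (dz φ z ρ - z * dz (dz φ) z ρ) := fun z ρ hp => by
    rw [← hs.dz_dr_comm hD.isOpen hp, dz_congr hD.isOpen h hp, ← hD.dz_Om hp]
    exact deriv_const_mul_field (v := fun t => Om φ t ρ) (x := z) (ρ * q ρ)
  refine ⟨fun z ρ hp => ?_, fun z ρ hp => ?_, fun z ρ hp => ?_⟩
  · have hL := hD.lam_ne _ hp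
    have hρ := (hD.pos _ hp).ne'
    simp only at hL hρ
    rw [U, h z ρ hp, h2 z ρ hp, Om]
    field_simp
    rw [Lam]
    ring
  · have hL := hD.lam_ne _ hp
    have hρ := (hD.pos _ hp).ne'
    simp only at hL hρ
    rw [V, h z ρ hp, h2 z ρ hp, Om]
    field_simp
    rw [Lam]
    ring
  · have hO := hD.om_ne _ hp
    have hρ := (hD.pos _ hp).ne'
    simp only at hO hρ
    rw [W, h z ρ hp]
    field_simp
    ring

theorem flatCoeffs_of_dim_one (hq : ∀ ρ ∈ I, DifferentiableAt ℝ q ρ) :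
    FlatCoeffs 1 I (fun _ => 0) q := fun ρ hρ =>
  ⟨0, deriv q ρ, hasDerivAt_const _ _, (hq ρ hρ).hasDerivAt, by simp, Or.inl rfl⟩

theorem flatCoeffs_zero (n : ℕ) (I : Set ℝ) : FlatCoeffs n I (fun _ => 0) fun _ => 0 :=
  fun ρ _ => ⟨0, 0, hasDerivAt_const _ _, hasDerivAt_const _ _, by simp, Or.inr (by simp)⟩

theorem hasDerivAt_const_div_sq (c : ℝ) {ρ : ℝ} (hρ : ρ ≠ 0) :
    HasDerivAt (fun ρ : ℝ => c / ρ ^ 2) (-2 * c / ρ ^ 3) ρ := by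
  refine ((hasDerivAt_const ρ c).fun_div (hasDerivAt_pow 2 ρ) (pow_ne_zero 2 hρ)).congr_deriv ?_
  simp
  field_simp

theorem flatCoeffs_inversion (n : ℕ) (hI : ∀ ρ ∈ I, 0 < ρ) :
    FlatCoeffs n I (fun _ => 0) fun ρ => -2 / ρ ^ 2 := fun ρ hρ => by
  have h0 := (hI ρ hρ).ne'
  refine ⟨0, _, hasDerivAt_const _ _, hasDerivAt_const_div_sq _ h0, by simp, Or.inr ⟨?_, ?_⟩⟩
  · field_simp
    ring
  · field_simp
    ring

theorem flatCoeffs_two (c : ℝ) (hI : ∀ ρ ∈ I, 0 < ρ) :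
    FlatCoeffs 2 I (fun _ => 0) fun ρ => c / ρ ^ 2 := fun ρ hρ => by
  have h0 := (hI ρ hρ).ne'
  refine ⟨0, _, hasDerivAt_const _ _, hasDerivAt_const_div_sq _ h0, by simp, Or.inr ⟨?_, ?_⟩⟩
  · push_cast
    field_simp
    ring
  · push_cast
    field_simp
    ring

/-! ### Riemannian and Lorentzian metrics `a(ρ) z² + b(ρ)` -/

section Riemannian

variable {a b : ℝ → ℝ}

theorem dz_quadratic (a b : ℝ → ℝ) :
    dz (fun z ρ => a ρ * z ^ 2 + b ρ) = fun z ρ => 2 * a ρ * z := by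
  funext z ρ
  refine (((hasDerivAt_pow 2 z).const_mul (a ρ)).add_const (b ρ)).deriv.trans ?_
  simp
  ring

theorem dz_dz_quadratic (a b : ℝ → ℝ) :
    dz (dz (fun z ρ => a ρ * z ^ 2 + b ρ)) = fun _ ρ => 2 * a ρ := by
  rw [dz_quadratic]
  funext z ρ
  exact ((hasDerivAt_id z).const_mul (2 * a ρ)).deriv.trans (by simp)

theorem Om_quadratic (a b : ℝ → ℝ) (z ρ : ℝ) :
    Om (fun z ρ => a ρ * z ^ 2 + b ρ) z ρ = 2 * b ρ := by
  rw [Om, dz_quadratic]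
  ring

theorem Lam_quadratic (a b : ℝ → ℝ) (z ρ : ℝ) :
    Lam (fun z ρ => a ρ * z ^ 2 + b ρ) z ρ = 4 * (a ρ * b ρ) := by
  rw [Lam, dz_dz_quadratic, dz_quadratic]
  ring

theorem ne_zero_of_regular_quadratic (hD : IsRegularDomain (fun z ρ => a ρ * z ^ 2 + b ρ) D)
    {ρ : ℝ} (hρ : ρ ∈ Prod.snd '' D) : a ρ ≠ 0 ∧ b ρ ≠ 0 := by
  obtain ⟨t, ht, rfl⟩ := hρ
  have := hD.lam_ne t ht
  rw [Lam_quadratic] at this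
  exact mul_ne_zero_iff.1 (mul_ne_zero_iff.1 this).2

theorem stronglyRicciFlat_quadratic (hD : IsRegularDomain (fun z ρ => a ρ * z ^ 2 + b ρ) D)
    (ha : ∀ ρ ∈ Prod.snd '' D, HasDerivAt a (2 * ρ * p ρ * a ρ) ρ)
    (hb : ∀ ρ ∈ Prod.snd '' D, HasDerivAt b (2 * ρ * q ρ * b ρ) ρ)
    (hF : FlatCoeffs n (Prod.snd '' D) p q) :
    StronglyRicciFlat n (fun z ρ => a ρ * z ^ 2 + b ρ) D := by
  have hdr : ∀ z ρ, (z, ρ) ∈ D → dr (fun z ρ => a ρ * z ^ 2 + b ρ) z ρ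
      = 2 * ρ * p ρ * a ρ * z ^ 2 + 2 * ρ * q ρ * b ρ := fun z ρ hp => by
    have hρ : ρ ∈ Prod.snd '' D := ⟨_, hp, rfl⟩
    exact (((ha ρ hρ).mul_const (z ^ 2)).add (hb ρ hρ)).deriv
  have hdrz : ∀ z ρ, (z, ρ) ∈ D → dr (dz (fun z ρ => a ρ * z ^ 2 + b ρ)) z ρ
      = 2 * (2 * ρ * p ρ * a ρ) * z := fun z ρ hp => by
    have hρ : ρ ∈ Prod.snd '' D := ⟨_, hp, rfl⟩
    rw [dz_quadratic]
    exact (((ha ρ hρ).const_mul 2).mul_const z).deriv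
  have hQ : HasQuadraticSpray (fun z ρ => a ρ * z ^ 2 + b ρ) D p q
      (fun ρ => p ρ * a ρ / (2 * b ρ)) := by
    refine ⟨fun z ρ hp => ?_, fun z ρ hp => ?_, fun z ρ hp => ?_⟩ <;>
    obtain ⟨h1, h2⟩ := ne_zero_of_regular_quadratic hD (ρ := ρ) ⟨_, hp, rfl⟩ <;>
    have hρ := (hD.pos _ hp).ne' <;>
    simp only at hρ
    · rw [U, hdr z ρ hp, hdrz z ρ hp, Lam_quadratic, dz_quadratic]
      field_simp
      ring
    · rw [V, hdr z ρ hp, hdrz z ρ hp, Lam_quadratic, dz_dz_quadratic, dz_quadratic]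
      field_simp
      ring
    · rw [W, hdr z ρ hp, Om_quadratic]
      field_simp
      ring
  refine hQ.stronglyRicciFlat hD hF fun ρ hρ => ?_
  obtain ⟨h1, h2⟩ := ne_zero_of_regular_quadratic hD hρ
  obtain ⟨p', q', hp, -, h0, -⟩ := hF ρ hρ
  have h3 : ρ ≠ 0 := by
    obtain ⟨t, ht, rfl⟩ := hρ
    exact (hD.pos t ht).ne'
  refine ((hp.mul (ha ρ hρ)).fun_div ((hb ρ hρ).const_mul 2) (by simpa using h2)).congr_deriv ?_
  simp only [Pi.mul_apply]
  field_simp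
  linear_combination h0

end Riemannian

end Flat

section Families

variable {n : ℕ} {D : Set (ℝ × ℝ)} {I : Set ℝ} {φ : ℝ → ℝ → ℝ} {q : ℝ → ℝ}

theorem hasDerivAt_abs_rpow {f : ℝ → ℝ} {f' x : ℝ} (hf : HasDerivAt f f' x) (h : f x ≠ 0)
    (c : ℝ) : HasDerivAt (fun x => |f x| ^ c) (c * (f' / f x) * |f x| ^ c) x := by
  have e : ∀ w : ℝ, w ≠ 0 → |w| ^ c = Real.exp (c * Real.log w) := fun w hw => by
    rw [Real.rpow_def_of_pos (abs_pos.2 hw), Real.log_abs, mul_comm]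
  have h1 := ((hf.log h).const_mul c).exp
  have h2 : (fun x => |f x| ^ c) =ᶠ[nhds x] fun x => Real.exp (c * Real.log (f x)) := by
    filter_upwards [hf.continuousAt.eventually_ne h] with t ht using e _ ht
  refine (h1.congr_of_eventuallyEq h2).congr_deriv ?_
  rw [e _ h]
  ring

theorem hasDerivAt_zpow_pos (m : ℤ) {ρ : ℝ} (hρ : ρ ≠ 0) :
    HasDerivAt (fun ρ : ℝ => ρ ^ m) (m * ρ ^ m / ρ) ρ := by
  refine (hasDerivAt_zpow m ρ (Or.inl hρ)).congr_deriv ?_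
  rw [zpow_sub_one₀ hρ]
  ring

theorem IsRegularDomain.pos_of_mem_image (hD : IsRegularDomain φ D) :
    ∀ ρ ∈ Prod.snd '' D, 0 < ρ := by
  rintro ρ ⟨t, ht, rfl⟩
  exact hD.pos t ht

theorem IsRegularDomain.contDiffAt_of_image (hD : IsRegularDomain φ D) {f : ℝ → ℝ}
    (hf : ContDiffOn ℝ ∞ f (Prod.snd '' D)) {ρ : ℝ} (hρ : ρ ∈ Prod.snd '' D) :
    ContDiffAt ℝ ∞ f ρ :=
  hf.contDiffAt ((isOpen_image_snd hD).mem_nhds hρ)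

theorem IsRegularDomain.continuousAt_snd (hD : IsRegularDomain φ D) {z ρ : ℝ}
    (hp : (z, ρ) ∈ D) : ContinuousAt (fun t => φ z t) ρ := by
  have h : ContinuousAt (Function.uncurry φ) (z, ρ) :=
    (hD.smooth.contDiffAt (hD.isOpen.mem_nhds hp)).continuousAt
  exact ContinuousAt.comp (f := fun t => (z, t)) (g := Function.uncurry φ) h (by fun_prop)

/-- Two functions that are continuous at a point and agree near it agree at the point. -/
theorem eq_of_eventually_nhdsNE {f g : ℝ → ℝ} {t : ℝ} (hf : ContinuousAt f t)
    (hg : ContinuousAt g t) (h : ∀ᶠ s in nhdsWithin t {t}ᶜ, f s = g s) : f t = g t :=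
  ((hf.eventuallyEq_nhds_iff_eventuallyEq_nhdsNE hg).1 h).eq_of_nhds

/-- The conclusion for metrics `φ(z, ρ) = H(z, h(ρ))` with `H` homogeneous of degree two. -/
theorem stronglyRicciFlat_of_dr_eq (hD : IsRegularDomain φ D)
    (h : ∀ z ρ, (z, ρ) ∈ D → dr φ z ρ = ρ * q ρ * Om φ z ρ)
    (hF : FlatCoeffs n (Prod.snd '' D) (fun _ => 0) q) :
    StronglyRicciFlat n φ D :=
  (hasQuadraticSpray_of_dr_eq hD h).stronglyRicciFlat hD hF fun ρ _ =>
    (hasDerivAt_const ρ (0 : ℝ)).congr_deriv (by simp)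

/-! ### The Schwarzschild metrics and the warped products over a cylinder -/

theorem flatCoeffs_schwarzschild {u : ℝ → ℝ} {C : ℝ} (hI : ∀ ρ ∈ I, 0 < ρ)
    (hu : ∀ ρ ∈ I, HasDerivAt u ((2 - n) * u ρ / ρ) ρ) (h1 : ∀ ρ ∈ I, C - u ρ ≠ 0)
    (h2 : ∀ ρ ∈ I, C + u ρ ≠ 0) :
    FlatCoeffs n I (fun ρ => 2 * (n - 2) * C * u ρ / (ρ ^ 2 * ((C - u ρ) * (C + u ρ))))
      (fun ρ => -2 * u ρ / (ρ ^ 2 * (C + u ρ))) := fun ρ hρ => by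
  have h0 := (hI ρ hρ).ne'
  have h1 := h1 ρ hρ
  have h2 := h2 ρ hρ
  have hu := hu ρ hρ
  have hp := (hu.const_mul (2 * ((n : ℝ) - 2) * C)).fun_div
    ((hasDerivAt_pow 2 ρ).mul ((hu.const_sub C).mul (hu.const_add C)))
    (mul_ne_zero (pow_ne_zero 2 h0) (mul_ne_zero h1 h2))
  have hq := (hu.const_mul (-2)).fun_div ((hasDerivAt_pow 2 ρ).mul (hu.const_add C))
    (mul_ne_zero (pow_ne_zero 2 h0) h2)
  refine ⟨_, _, hp, hq, ?_, Or.inr ⟨?_, ?_⟩⟩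
  · simp only [Pi.mul_apply]
    generalize u ρ = w at *
    push_cast
    field_simp
    ring
  · simp only [Pi.mul_apply]
    generalize u ρ = w at *
    push_cast
    field_simp
    ring
  · simp only [Pi.mul_apply]
    generalize u ρ = w at *
    push_cast
    field_simp
    ring

/-- The metric cannot be regular on the sphere where the spatial factor vanishes: there the
coefficient of `z²` is unbounded. -/
theorem schwarzschild_add_ne_zero {A B C σ : ℝ} (hn : 3 ≤ n) (hA : 0 < A)
    (hD : IsRegularDomain (fun z ρ =>
        A * ((C - ρ ^ (2 - (n : ℤ))) / (C + ρ ^ (2 - (n : ℤ)))) ^ 2 * z ^ 2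
          + σ * (B * |ρ ^ (2 - (n : ℤ)) + C| ^ (4 / ((n : ℝ) - 2)))) D) :
    ∀ ρ ∈ Prod.snd '' D, C + ρ ^ (2 - (n : ℤ)) ≠ 0 := by
  intro ρ hρI hw
  have hρ := hD.pos_of_mem_image ρ hρI
  have hn' : (3 : ℝ) ≤ n := by exact_mod_cast hn
  obtain ⟨⟨z0, ρ'⟩, hz0, rfl⟩ := hρI
  simp only at hw hρ
  -- a point of the same slice with `z ≠ 0`
  obtain ⟨z, hz, hzD⟩ : ∃ z : ℝ, z ≠ 0 ∧ (z, ρ') ∈ D := by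
    have h1 : ∀ᶠ z in nhdsWithin z0 {z0}ᶜ, (z, ρ') ∈ D :=
      nhdsWithin_le_nhds ((by fun_prop : ContinuousAt (fun z : ℝ => (z, ρ')) z0)
        (hD.isOpen.mem_nhds hz0))
    by_cases h : z0 = 0
    · obtain ⟨z, hzD, hzne⟩ := (h1.and self_mem_nhdsWithin).exists
      exact ⟨z, fun h' => hzne (by rw [h', h]; rfl), hzD⟩
    · exact ⟨z0, h, hz0⟩
  have hu := hasDerivAt_zpow_pos (2 - (n : ℤ)) hρ.ne'
  have huc := hu.continuousAt
  have hu0 : ρ' ^ (2 - (n : ℤ)) ≠ 0 := zpow_ne_zero _ hρ.ne'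
  have hune : ∀ᶠ ρ in nhdsWithin ρ' {ρ'}ᶜ, ρ ^ (2 - (n : ℤ)) ≠ -C := by
    refine hu.eventually_ne (div_ne_zero (mul_ne_zero ?_ hu0) hρ.ne')
    exact_mod_cast (show (2 - (n : ℤ)) ≠ 0 by omega)
  have h4 : 0 ≤ 4 / ((n : ℝ) - 2) := by apply div_nonneg <;> linarith
  have key := eq_of_eventually_nhdsNE (t := ρ')
    (f := fun ρ => (A * ((C - ρ ^ (2 - (n : ℤ))) / (C + ρ ^ (2 - (n : ℤ)))) ^ 2 * z ^ 2
          + σ * (B * |ρ ^ (2 - (n : ℤ)) + C| ^ (4 / ((n : ℝ) - 2))))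
          * (C + ρ ^ (2 - (n : ℤ))) ^ 2)
    (g := fun ρ => A * (C - ρ ^ (2 - (n : ℤ))) ^ 2 * z ^ 2
          + σ * (B * |ρ ^ (2 - (n : ℤ)) + C| ^ (4 / ((n : ℝ) - 2)))
          * (C + ρ ^ (2 - (n : ℤ))) ^ 2)
    ((hD.continuousAt_snd hzD).mul ((huc.const_add C).pow 2))
    ((((((continuousAt_const (y := C)).sub huc).pow 2).const_mul A).mul_const (z ^ 2)).add
      (((((huc.add_const C).abs.rpow_const (Or.inr h4)).const_mul B).const_mul σ).mul
        ((huc.const_add C).pow 2)))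
    (by
      filter_upwards [hune] with ρ hρ
      have : C + ρ ^ (2 - (n : ℤ)) ≠ 0 := fun h => hρ (by linarith)
      field_simp)
  simp only [hw] at key
  have hC : C - ρ' ^ (2 - (n : ℤ)) ≠ 0 := fun h => hu0 (by linarith)
  have : A * (C - ρ' ^ (2 - (n : ℤ))) ^ 2 * z ^ 2 ≠ 0 := by positivity
  apply this
  linarith

theorem stronglyRicciFlat_schwarzschild {A B C σ : ℝ} (hn : 3 ≤ n) (hA : 0 < A)
    (hD : IsRegularDomain (fun z ρ =>
        A * ((C - ρ ^ (2 - (n : ℤ))) / (C + ρ ^ (2 - (n : ℤ)))) ^ 2 * z ^ 2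
          + σ * (B * |ρ ^ (2 - (n : ℤ)) + C| ^ (4 / ((n : ℝ) - 2)))) D) :
    StronglyRicciFlat n (fun z ρ =>
        A * ((C - ρ ^ (2 - (n : ℤ))) / (C + ρ ^ (2 - (n : ℤ)))) ^ 2 * z ^ 2
          + σ * (B * |ρ ^ (2 - (n : ℤ)) + C| ^ (4 / ((n : ℝ) - 2)))) D := by
  have hpos := hD.pos_of_mem_image
  have h2 := schwarzschild_add_ne_zero hn hA hD
  have h1 : ∀ ρ ∈ Prod.snd '' D, C - ρ ^ (2 - (n : ℤ)) ≠ 0 := fun ρ hρ h => by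
    refine (ne_zero_of_regular_quadratic
      (a := fun ρ => A * ((C - ρ ^ (2 - (n : ℤ))) / (C + ρ ^ (2 - (n : ℤ)))) ^ 2)
      (b := fun ρ => σ * (B * |ρ ^ (2 - (n : ℤ)) + C| ^ (4 / ((n : ℝ) - 2)))) hD hρ).1 ?_
    simp [h]
  have hu : ∀ ρ ∈ Prod.snd '' D, HasDerivAt (fun ρ : ℝ => ρ ^ (2 - (n : ℤ)))
      ((2 - n) * ρ ^ (2 - (n : ℤ)) / ρ) ρ := fun ρ hρ =>
    (hasDerivAt_zpow_pos (2 - (n : ℤ)) (hpos ρ hρ).ne').congr_deriv (by push_cast; ring)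
  have hn' : (n : ℝ) - 2 ≠ 0 := by
    have : (3 : ℝ) ≤ n := by exact_mod_cast hn
    linarith
  refine stronglyRicciFlat_quadratic
    (a := fun ρ => A * ((C - ρ ^ (2 - (n : ℤ))) / (C + ρ ^ (2 - (n : ℤ)))) ^ 2)
    (b := fun ρ => σ * (B * |ρ ^ (2 - (n : ℤ)) + C| ^ (4 / ((n : ℝ) - 2)))) hD
    (fun ρ hρ => ?_) (fun ρ hρ => ?_)
    (flatCoeffs_schwarzschild (u := fun ρ : ℝ => ρ ^ (2 - (n : ℤ))) (C := C) hpos hu h1 h2)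
  · have h0 := (hpos ρ hρ).ne'
    have h1 := h1 ρ hρ
    have h2 := h2 ρ hρ
    have hu := hu ρ hρ
    refine ((((hu.const_sub C).fun_div (hu.const_add C) h2).fun_pow 2).const_mul A).congr_deriv ?_
    generalize ρ ^ (2 - (n : ℤ)) = w at *
    push_cast
    field_simp
    ring
  · have h0 := (hpos ρ hρ).ne'
    have h2 : ρ ^ (2 - (n : ℤ)) + C ≠ 0 := by rw [add_comm]; exact h2 ρ hρ
    refine (((hasDerivAt_abs_rpow ((hu ρ hρ).add_const C) h2 _).const_mul B).const_mul
      σ).congr_deriv ?_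
    rw [add_comm C]
    generalize |ρ ^ (2 - (n : ℤ)) + C| ^ (4 / ((n : ℝ) - 2)) = E at *
    generalize ρ ^ (2 - (n : ℤ)) = w at *
    field_simp
    ring

theorem flatCoeffs_log {A₁ A₂ : ℝ} (hI : ∀ ρ ∈ I, 0 < ρ)
    (hl : ∀ ρ ∈ I, A₁ + A₂ * Real.log ρ ≠ 0) :
    FlatCoeffs 2 I (fun ρ => A₂ / (ρ ^ 2 * (A₁ + A₂ * Real.log ρ))) (fun ρ => -1 / ρ ^ 2) :=
  fun ρ hρ => by
  have h0 := (hI ρ hρ).ne'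
  have hl := hl ρ hρ
  refine ⟨_, _, (hasDerivAt_const ρ A₂).fun_div ((hasDerivAt_pow 2 ρ).mul
    (((Real.hasDerivAt_log h0).const_mul A₂).const_add A₁)) (mul_ne_zero (pow_ne_zero 2 h0) hl),
    hasDerivAt_const_div_sq _ h0, ?_, Or.inr ⟨?_, ?_⟩⟩
  · beta_reduce
    generalize Real.log ρ = l at *
    push_cast
    field_simp
    ring
  · push_cast
    field_simp
    ring
  · beta_reduce
    generalize Real.log ρ = l at *
    push_cast
    field_simp
    ring

/-! ### Root metrics and Randers metrics -/

theorem powTwoDiv_pow {m : ℕ} (hm : 2 < m) (a : ℝ) : powTwoDiv m a ^ m = a ^ 2 := by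
  have hm0 : (m : ℝ) ≠ 0 := by positivity
  have key : ∀ c : ℝ, 0 ≤ c → (c ^ (2 / (m : ℝ))) ^ m = c ^ 2 := fun c hc => by
    rw [← Real.rpow_natCast, ← Real.rpow_mul hc, div_mul_cancel₀ _ hm0]
    exact_mod_cast Real.rpow_natCast c 2
  unfold powTwoDiv
  split_ifs with h h'
  · exact key a h
  · rw [key _ (by linarith)]
    ring
  · rw [(Nat.not_odd_iff_even.1 h').neg_pow, key _ (by linarith)]
    ring

/-- At points where the radicand `P = A z^m + σ b` does not vanish the equation follows from
`φ^m = P²` by differentiation. The zeros of `P` are isolated in the slices `ρ = const`. -/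
theorem dr_root_eq {m : ℕ} {A σ : ℝ} {b : ℝ → ℝ} (hm : 2 < m) (hA : 0 < A) (hσ : σ ≠ 0)
    (hD : IsRegularDomain (fun z ρ => powTwoDiv m (A * z ^ m + σ * b ρ)) D)
    (hb0 : ∀ ρ ∈ Prod.snd '' D, b ρ ≠ 0)
    (hb : ∀ ρ ∈ Prod.snd '' D, HasDerivAt b (m * ρ * q ρ * b ρ) ρ) (z ρ : ℝ) (hp : (z, ρ) ∈ D) :
    dr (fun z ρ => powTwoDiv m (A * z ^ m + σ * b ρ)) z ρ
      = ρ * q ρ * Om (fun z ρ => powTwoDiv m (A * z ^ m + σ * b ρ)) z ρ := by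
  set φ : ℝ → ℝ → ℝ := fun z ρ => powTwoDiv m (A * z ^ m + σ * b ρ) with hφ
  have hs : Smooth D φ := hD.smooth
  have hpow : ∀ z ρ, φ z ρ ^ m = (A * z ^ m + σ * b ρ) ^ 2 := fun z ρ => powTwoDiv_pow hm _
  have hm1 : m ≠ 0 := by omega
  have hm0 : (m : ℝ) ≠ 0 := by exact_mod_cast hm1
  have main : ∀ z, (z, ρ) ∈ D → A * z ^ m + σ * b ρ ≠ 0 →
      dr φ z ρ = ρ * q ρ * Om φ z ρ := fun z hp hP => by
    have hρI : ρ ∈ Prod.snd '' D := ⟨_, hp, rfl⟩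
    have hφ0 : φ z ρ ≠ 0 := fun h => by
      have := hpow z ρ
      rw [h, zero_pow hm1] at this
      exact pow_ne_zero 2 hP this.symm
    have dφz : HasDerivAt (fun t => φ t ρ) (dz φ z ρ) z := by
      have hc : DifferentiableAt ℝ (fun t => φ t ρ) z :=
        (hs.differentiableAt hD.isOpen hp).comp (f := fun t : ℝ => (t, ρ)) z (by fun_prop)
      exact hc.hasDerivAt
    have dφr : HasDerivAt (fun t => φ z t) (dr φ z ρ) ρ := by
      have hc : DifferentiableAt ℝ (fun t => φ z t) ρ :=
        (hs.differentiableAt hD.isOpen hp).comp (f := fun t : ℝ => (z, t)) ρ (by fun_prop)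
      exact hc.hasDerivAt
    have ez := (dφz.fun_pow m).unique
      (((((hasDerivAt_pow m z).const_mul A).add_const (σ * b ρ)).fun_pow 2).congr_of_eventuallyEq
        (Filter.Eventually.of_forall fun t => hpow t ρ))
    have er := (dφr.fun_pow m).unique
      (((((hb ρ hρI).const_mul σ).const_add (A * z ^ m)).fun_pow 2).congr_of_eventuallyEq
        (Filter.Eventually.of_forall fun t => hpow z t))
    have e1 : z ^ (m - 1) * z = z ^ m := pow_sub_one_mul hm1 z
    have e2 : φ z ρ ^ (m - 1) * φ z ρ = (A * z ^ m + σ * b ρ) ^ 2 := by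
      rw [pow_sub_one_mul hm1, hpow]
    simp only [Nat.cast_ofNat, Nat.add_one_sub_one, pow_one] at ez er
    have e3 : (m * φ z ρ ^ (m - 1)) * (dr φ z ρ - ρ * q ρ * Om φ z ρ) = 0 := by
      rw [Om]
      linear_combination er + ρ * q ρ * z * ez - 2 * m * ρ * q ρ * e2
        + 2 * m * ρ * q ρ * (A * z ^ m + σ * b ρ) * A * e1
    have e4 : (m * φ z ρ ^ (m - 1)) ≠ 0 := mul_ne_zero hm0 (pow_ne_zero _ hφ0)
    exact sub_eq_zero.1 ((mul_eq_zero.1 e3).resolve_left e4)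
  by_cases hP : A * z ^ m + σ * b ρ = 0
  · have hρI : ρ ∈ Prod.snd '' D := ⟨_, hp, rfl⟩
    have hz : z ≠ 0 := fun h => by
      rw [h, zero_pow hm1, mul_zero, zero_add] at hP
      exact mul_ne_zero hσ (hb0 ρ hρI) hP
    have hne := (((hasDerivAt_pow m z).const_mul A).add_const (σ * b ρ)).eventually_ne
      (c := 0) (mul_ne_zero hA.ne' (mul_ne_zero hm0 (pow_ne_zero _ hz)))
    have hmem : ∀ᶠ t in nhdsWithin z {z}ᶜ, (t, ρ) ∈ D :=
      nhdsWithin_le_nhds ((by fun_prop : ContinuousAt (fun t : ℝ => (t, ρ)) z)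
        (hD.isOpen.mem_nhds hp))
    have hslice : ∀ {f : ℝ → ℝ → ℝ}, Smooth D f → ContinuousAt (fun t => f t ρ) z := fun {f} hf =>
      ContinuousAt.comp (f := fun t => (t, ρ)) (g := Function.uncurry f)
        (hf.differentiableAt hD.isOpen hp).continuousAt (by fun_prop)
    refine eq_of_eventually_nhdsNE (t := z) (f := fun t => dr φ t ρ)
      (g := fun t => ρ * q ρ * Om φ t ρ) (hslice (hs.dr hD.isOpen))
      ((hslice hD.smooth_Om).const_mul _) ?_
    filter_upwards [hne, hmem] with t h1 h2 using main t h2 h1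
  · exact main z hp hP

/-- The metric cannot be regular where `ρ² + C = 0`: there the radicand is unbounded. -/
theorem root_sq_add_ne_zero {m : ℕ} {A B C σ : ℝ} (hm : 2 < m) (hB : 0 < B) (hσ : σ ≠ 0)
    (hD : IsRegularDomain (fun z ρ =>
      powTwoDiv m (A * z ^ m + σ * (B * |ρ ^ 2 + C| ^ (-(m : ℤ))))) D) :
    ∀ ρ ∈ Prod.snd '' D, ρ ^ 2 + C ≠ 0 := by
  intro ρ hρI hw
  have hρ := hD.pos_of_mem_image ρ hρI
  obtain ⟨⟨z, ρ'⟩, hz, rfl⟩ := hρI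
  simp only at hw hρ
  have hm1 : m ≠ 0 := by omega
  have hu : HasDerivAt (fun ρ : ℝ => ρ ^ 2 + C) (2 * ρ') ρ' := by
    simpa using (hasDerivAt_pow 2 ρ').add_const C
  have hune := hu.eventually_ne (c := 0) (by positivity)
  have key := eq_of_eventually_nhdsNE (t := ρ')
    (f := fun ρ => powTwoDiv m (A * z ^ m + σ * (B * |ρ ^ 2 + C| ^ (-(m : ℤ)))) ^ m
      * (|ρ ^ 2 + C| ^ m) ^ 2)
    (g := fun ρ => (A * z ^ m * |ρ ^ 2 + C| ^ m + σ * B) ^ 2)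
    (((hD.continuousAt_snd hz).pow m).mul (by fun_prop)) (by fun_prop)
    (by
      filter_upwards [hune] with ρ hρ
      have h1 : |ρ ^ 2 + C| ^ m ≠ 0 := pow_ne_zero m (abs_ne_zero.2 hρ)
      rw [powTwoDiv_pow hm, zpow_neg, zpow_natCast]
      field_simp)
  simp only [hw, abs_zero, zero_pow hm1] at key
  have : (σ * B) ^ 2 ≠ 0 := pow_ne_zero 2 (mul_ne_zero hσ hB.ne')
  apply this
  linarith

theorem dr_randers_eq {A ε : ℝ} {b : ℝ → ℝ} (hA : 0 < A)
    (hb0 : ∀ ρ ∈ Prod.snd '' D, 0 < b ρ)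
    (hb : ∀ ρ ∈ Prod.snd '' D, HasDerivAt b (2 * ρ * q ρ * b ρ) ρ) (z ρ : ℝ) (hp : (z, ρ) ∈ D) :
    dr (fun z ρ => (Real.sqrt (A * z ^ 2 + b ρ) + ε * Real.sqrt A * z) ^ 2) z ρ
      = ρ * q ρ * Om (fun z ρ => (Real.sqrt (A * z ^ 2 + b ρ) + ε * Real.sqrt A * z) ^ 2) z ρ := by
  have hρI : ρ ∈ Prod.snd '' D := ⟨_, hp, rfl⟩
  have hpos : 0 < A * z ^ 2 + b ρ := by
    have := hb0 ρ hρI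
    positivity
  have hS := Real.sqrt_pos.2 hpos
  have hS2 := Real.sq_sqrt hpos.le
  have dr' := ((((hb ρ hρI).const_add (A * z ^ 2)).sqrt hpos.ne').add_const
    (ε * Real.sqrt A * z)).fun_pow 2
  have dz' := (((((hasDerivAt_pow 2 z).const_mul A).add_const (b ρ)).sqrt hpos.ne').add
    ((hasDerivAt_id z).const_mul (ε * Real.sqrt A))).fun_pow 2
  have er : dr (fun z ρ => (Real.sqrt (A * z ^ 2 + b ρ) + ε * Real.sqrt A * z) ^ 2) z ρ = _ :=
    dr'.deriv
  have ez : dz (fun z ρ => (Real.sqrt (A * z ^ 2 + b ρ) + ε * Real.sqrt A * z) ^ 2) z ρ = _ :=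
    dz'.deriv
  rw [Om, er, ez]
  simp only [Pi.add_apply, id_eq]
  generalize Real.sqrt (A * z ^ 2 + b ρ) = S at *
  have hbS : b ρ = S ^ 2 - A * z ^ 2 := by linarith
  rw [hbS]
  push_cast
  field_simp
  ring

end Families

/-! ### The constructed solutions -/

section Constructed

variable {n : ℕ} {D : Set (ℝ × ℝ)} {φ : ℝ → ℝ → ℝ} {q : ℝ → ℝ}

theorem IsSign.ne_zero {σ : ℝ} (h : IsSign σ) : σ ≠ 0 := by
  rcases h with h | h <;> norm_num [h]

theorem IsRootSign.ne_zero {m : ℕ} {σ : ℝ} (h : IsRootSign m σ) : σ ≠ 0 := by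
  rcases h.2 with h | ⟨h, -⟩ <;> norm_num [h]

theorem hasDerivAt_mul_abs_rpow (B c : ℝ) {ρ : ℝ} (hρ : ρ ≠ 0) :
    HasDerivAt (fun ρ => B * |ρ| ^ c) (c / ρ * (B * |ρ| ^ c)) ρ :=
  ((hasDerivAt_abs_rpow (f := fun ρ => ρ) (hasDerivAt_id ρ) hρ c).const_mul B).congr_deriv
    (by ring)

theorem hasDerivAt_exp_of_contDiffAt {g : ℝ → ℝ} {ρ : ℝ} (hg : ContDiffAt ℝ ∞ g ρ) :
    HasDerivAt (fun ρ => Real.exp (g ρ)) (deriv g ρ * Real.exp (g ρ)) ρ :=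
  (hg.differentiableAt (by simp)).hasDerivAt.exp.congr_deriv (mul_comm _ _)

theorem contDiffAt_deriv {g : ℝ → ℝ} {ρ : ℝ} (hg : ContDiffAt ℝ ∞ g ρ) :
    ContDiffAt ℝ ∞ (deriv g) ρ :=
  hg.derivWithin (by simp)

/-- `φ = e^f (z² + σ B f'²)` with `n = 1` is conformal to the flat metric `z² + σ B f'²` with
the factor `e^f`, and `√B f` is a linear coordinate of that metric; hence it is flat. -/
theorem stronglyRicciFlat_exp_mul {B σ : ℝ} {f : ℝ → ℝ}
    (hD : IsRegularDomain (fun z ρ => Real.exp (f ρ) * (z ^ 2 + σ * (B * (deriv f ρ) ^ 2))) D)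
    (hf : ContDiffOn ℝ ∞ f (Prod.snd '' D)) :
    StronglyRicciFlat 1 (fun z ρ => Real.exp (f ρ) * (z ^ 2 + σ * (B * (deriv f ρ) ^ 2))) D := by
  have hpos := hD.pos_of_mem_image
  have hfa := fun ρ hρ => hD.contDiffAt_of_image hf (ρ := ρ) hρ
  have e : (fun z ρ => Real.exp (f ρ) * (z ^ 2 + σ * (B * (deriv f ρ) ^ 2)))
      = fun z ρ => (fun ρ => Real.exp (f ρ)) ρ * z ^ 2
        + (fun ρ => Real.exp (f ρ) * (σ * (B * (deriv f ρ) ^ 2))) ρ := by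
    funext z ρ
    ring
  rw [e] at hD ⊢
  have hf' : ∀ ρ ∈ Prod.snd '' D, deriv f ρ ≠ 0 := fun ρ hρ h => by
    refine (ne_zero_of_regular_quadratic hD hρ).2 ?_
    simp [h]
  refine stronglyRicciFlat_quadratic (p := fun ρ => deriv f ρ / (2 * ρ))
    (q := fun ρ => (deriv f ρ + 2 * deriv (deriv f) ρ / deriv f ρ) / (2 * ρ)) hD
    (fun ρ hρ => ?_) (fun ρ hρ => ?_) (fun ρ hρ => ?_)
  · have h0 := (hpos ρ hρ).ne'
    refine (hasDerivAt_exp_of_contDiffAt (hfa ρ hρ)).congr_deriv ?_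
    field_simp
  · have h0 := (hpos ρ hρ).ne'
    have h1 := hf' ρ hρ
    have h2 := ((contDiffAt_deriv (hfa ρ hρ)).differentiableAt (by simp)).hasDerivAt
    refine ((hasDerivAt_exp_of_contDiffAt (hfa ρ hρ)).mul
      (((h2.fun_pow 2).const_mul B).const_mul σ)).congr_deriv ?_
    push_cast
    field_simp
  · have h0 := (hpos ρ hρ).ne'
    have h1 := hf' ρ hρ
    have c1 := contDiffAt_deriv (hfa ρ hρ)
    have c2 := contDiffAt_deriv c1
    have d1 : DifferentiableAt ℝ (deriv f) ρ := c1.differentiableAt (by simp)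
    have d2 : DifferentiableAt ℝ (deriv (deriv f)) ρ := c2.differentiableAt (by simp)
    have hq : DifferentiableAt ℝ
        (fun ρ => (deriv f ρ + 2 * deriv (deriv f) ρ / deriv f ρ) / (2 * ρ)) ρ :=
      (d1.add ((d2.const_mul 2).div d1 h1)).div (differentiableAt_id.const_mul 2) (by simpa)
    refine ⟨_, _, d1.hasDerivAt.fun_div ((hasDerivAt_id ρ).const_mul 2) (by simpa), hq.hasDerivAt,
      ?_, Or.inl rfl⟩
    push_cast
    field_simp
    ring

theorem stronglyRicciFlat_log {A₁ A₂ B σ : ℝ}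
    (hD : IsRegularDomain (fun z ρ =>
      (A₁ + A₂ * Real.log |ρ|) ^ 2 * z ^ 2 + σ * (B * ρ ^ (-2 : ℤ))) D) :
    StronglyRicciFlat 2 (fun z ρ =>
      (A₁ + A₂ * Real.log |ρ|) ^ 2 * z ^ 2 + σ * (B * ρ ^ (-2 : ℤ))) D := by
  have hpos := hD.pos_of_mem_image
  simp only [Real.log_abs] at hD ⊢
  have hl : ∀ ρ ∈ Prod.snd '' D, A₁ + A₂ * Real.log ρ ≠ 0 := fun ρ hρ h => by
    refine (ne_zero_of_regular_quadratic (a := fun ρ => (A₁ + A₂ * Real.log ρ) ^ 2)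
      (b := fun ρ => σ * (B * ρ ^ (-2 : ℤ))) hD hρ).1 ?_
    simp [h]
  refine stronglyRicciFlat_quadratic (a := fun ρ => (A₁ + A₂ * Real.log ρ) ^ 2)
    (b := fun ρ => σ * (B * ρ ^ (-2 : ℤ))) hD (fun ρ hρ => ?_) (fun ρ hρ => ?_)
    (flatCoeffs_log hpos hl)
  · have h0 := (hpos ρ hρ).ne'
    have hl := hl ρ hρ
    refine ((((Real.hasDerivAt_log h0).const_mul A₂).const_add A₁).fun_pow 2).congr_deriv ?_
    push_cast
    field_simp
  · have h0 := (hpos ρ hρ).ne'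
    refine (((hasDerivAt_zpow_pos (-2) h0).const_mul B).const_mul σ).congr_deriv ?_
    push_cast
    field_simp

theorem IsConstructed.stronglyRicciFlat (h : IsConstructed n (Prod.snd '' D) φ)
    (hD : IsRegularDomain φ D) : StronglyRicciFlat n φ D := by
  have hpos := hD.pos_of_mem_image
  rcases h with ⟨A, B, σ, hn, hA, hB, hσ⟩ | ⟨A, B, C, σ, hn, hA, hB, hσ⟩ |
    ⟨A, B, C, σ, rfl, hA, hB, hC, hσ⟩ | ⟨A₁, A₂, B, σ, rfl, hB, hσ⟩ | ⟨A, σ, g, rfl, hA, hg, hσ⟩ |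
    ⟨B, σ, f, rfl, hB, hf, hσ⟩ | ⟨m, A, B, σ, hn, hA, hB, hσ⟩ | ⟨m, A, B, σ, hn, hA, hB, hσ⟩ |
    ⟨m, A, B, C, σ, rfl, hA, hB, hσ⟩ | ⟨m, A, B, σ, rfl, hA, hB, hσ⟩ |
    ⟨m, A, B, C, σ, rfl, hA, hB, hσ⟩ | ⟨A, B, ε, hn, hA, hB, hε, hε'⟩ |
    ⟨A, B, ε, hn, hA, hB, hε, hε'⟩ | ⟨A, B, C, ε, rfl, hA, hB, hε, hε'⟩ |
    ⟨A, ε, g, rfl, hA, hg, hε, hε'⟩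
  -- the metrics `a(ρ) z² + b(ρ)`
  · exact stronglyRicciFlat_quadratic (a := fun _ => A) (b := fun _ => σ * B) hD
      (fun ρ _ => (hasDerivAt_const ρ A).congr_deriv (by simp))
      (fun ρ _ => (hasDerivAt_const ρ (σ * B)).congr_deriv (by simp)) (flatCoeffs_zero _ _)
  · exact stronglyRicciFlat_schwarzschild hn hA hD
  · refine stronglyRicciFlat_quadratic (a := fun _ => A) (b := fun ρ => σ * (B * |ρ| ^ C)) hD
      (fun ρ _ => (hasDerivAt_const ρ A).congr_deriv (by simp))
      (fun ρ hρ => ?_) (flatCoeffs_two (C / 2) hpos)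
    have h0 := (hpos ρ hρ).ne'
    refine ((hasDerivAt_mul_abs_rpow B C h0).const_mul σ).congr_deriv ?_
    field_simp
  · exact stronglyRicciFlat_log hD
  · refine stronglyRicciFlat_quadratic (a := fun _ => A) (b := fun ρ => σ * Real.exp (g ρ))
      (q := fun ρ => deriv g ρ / (2 * ρ)) hD
      (fun ρ _ => (hasDerivAt_const ρ A).congr_deriv (by simp))
      (fun ρ hρ => ?_) (flatCoeffs_of_dim_one fun ρ hρ => ?_)
    · have h0 := (hpos ρ hρ).ne'
      refine ((hasDerivAt_exp_of_contDiffAt (hD.contDiffAt_of_image hg hρ)).const_mul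
        σ).congr_deriv ?_
      field_simp
    · exact ((contDiffAt_deriv (hD.contDiffAt_of_image hg hρ)).differentiableAt (by simp)).div
        (differentiableAt_id.const_mul 2) (by simpa using (hpos ρ hρ).ne')
  · exact stronglyRicciFlat_exp_mul hD hf
  -- the root metrics
  · exact stronglyRicciFlat_of_dr_eq hD (dr_root_eq (b := fun _ => B) hσ.1 hA hσ.ne_zero hD
      (fun _ _ => hB.ne') fun ρ _ => (hasDerivAt_const ρ B).congr_deriv (by simp))
      (flatCoeffs_zero _ _)
  · refine stronglyRicciFlat_of_dr_eq hD (dr_root_eq (b := fun ρ => B * ρ ^ (-2 * (m : ℤ)))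
      hσ.1 hA hσ.ne_zero hD
      (fun ρ hρ => mul_ne_zero hB.ne' (zpow_ne_zero _ (hpos ρ hρ).ne')) fun ρ hρ => ?_)
      (flatCoeffs_inversion n hpos)
    have h0 := (hpos ρ hρ).ne'
    refine ((hasDerivAt_zpow_pos (-2 * (m : ℤ)) h0).const_mul B).congr_deriv ?_
    generalize ρ ^ (-2 * (m : ℤ)) = w
    push_cast
    field_simp
  · refine stronglyRicciFlat_of_dr_eq hD (dr_root_eq (b := fun ρ => B * |ρ| ^ C)
      hσ.1 hA hσ.ne_zero hD
      (fun ρ hρ => mul_ne_zero hB.ne' (Real.rpow_pos_of_pos (abs_pos.2 (hpos ρ hρ).ne') _).ne')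
      fun ρ hρ => ?_) (flatCoeffs_two (C / m) hpos)
    have h0 := (hpos ρ hρ).ne'
    have hm : (m : ℝ) ≠ 0 := by
      have := hσ.1
      positivity
    refine (hasDerivAt_mul_abs_rpow B C h0).congr_deriv ?_
    field_simp
  · exact stronglyRicciFlat_of_dr_eq hD (dr_root_eq (b := fun _ => B) hσ.1 hA hσ.ne_zero hD
      (fun _ _ => hB.ne') fun ρ _ => (hasDerivAt_const ρ B).congr_deriv (by simp))
      (flatCoeffs_zero _ _)
  · have hw := root_sq_add_ne_zero hσ.1 hB hσ.ne_zero hD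
    have hu : ∀ ρ : ℝ, HasDerivAt (fun ρ : ℝ => ρ ^ 2 + C) (2 * ρ) ρ := fun ρ => by
      simpa using (hasDerivAt_pow 2 ρ).add_const C
    refine stronglyRicciFlat_of_dr_eq (q := fun ρ => -2 / (ρ ^ 2 + C)) hD
      (dr_root_eq (b := fun ρ => B * |ρ ^ 2 + C| ^ (-(m : ℤ))) hσ.1 hA hσ.ne_zero hD
      (fun ρ hρ => mul_ne_zero hB.ne' (zpow_ne_zero _ (abs_ne_zero.2 (hw ρ hρ)))) fun ρ hρ => ?_)
      (flatCoeffs_of_dim_one fun ρ hρ =>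
        (differentiableAt_const _).div (hu ρ).differentiableAt (hw ρ hρ))
    have e : ∀ w : ℝ, |w| ^ (-(m : ℤ)) = |w| ^ (-(m : ℝ)) := fun w => by
      rw [← Real.rpow_intCast]
      push_cast
      rfl
    simp only [e]
    refine ((hasDerivAt_abs_rpow (hu ρ) (hw ρ hρ) _).const_mul B).congr_deriv ?_
    ring
  -- the Randers metrics
  · exact stronglyRicciFlat_of_dr_eq hD (dr_randers_eq (b := fun _ => B) hA (fun _ _ => hB)
      fun ρ _ => (hasDerivAt_const ρ B).congr_deriv (by simp)) (flatCoeffs_zero _ _)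
  · refine stronglyRicciFlat_of_dr_eq hD (dr_randers_eq (b := fun ρ => B * ρ ^ (-4 : ℤ)) hA
      (fun ρ hρ => mul_pos hB (zpow_pos (hpos ρ hρ) _)) fun ρ hρ => ?_)
      (flatCoeffs_inversion n hpos)
    have h0 := (hpos ρ hρ).ne'
    refine ((hasDerivAt_zpow_pos (-4) h0).const_mul B).congr_deriv ?_
    generalize ρ ^ (-4 : ℤ) = w
    push_cast
    field_simp
    ring
  · refine stronglyRicciFlat_of_dr_eq hD (dr_randers_eq (b := fun ρ => B * |ρ| ^ C) hA
      (fun ρ hρ => mul_pos hB (Real.rpow_pos_of_pos (abs_pos.2 (hpos ρ hρ).ne') _))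
      fun ρ hρ => ?_) (flatCoeffs_two (C / 2) hpos)
    have h0 := (hpos ρ hρ).ne'
    refine (hasDerivAt_mul_abs_rpow B C h0).congr_deriv ?_
    field_simp
  · refine stronglyRicciFlat_of_dr_eq (q := fun ρ => deriv g ρ / (2 * ρ)) hD
      (dr_randers_eq (b := fun ρ => Real.exp (g ρ)) hA (fun ρ _ => Real.exp_pos _)
      fun ρ hρ => ?_) (flatCoeffs_of_dim_one fun ρ hρ => ?_)
    · have h0 := (hpos ρ hρ).ne'
      refine (hasDerivAt_exp_of_contDiffAt (hD.contDiffAt_of_image hg hρ)).congr_deriv ?_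
      field_simp
    · exact ((contDiffAt_deriv (hD.contDiffAt_of_image hg hρ)).differentiableAt (by simp)).div
        (differentiableAt_id.const_mul 2) (by simpa using (hpos ρ hρ).ne')

end Constructed

end WarpedFinsler

end

theorem mainTheorem4 (n : ℕ) (hn : 1 ≤ n) (φ : ℝ → ℝ → ℝ) (D : Set (ℝ × ℝ))
    (hD : IsRegularDomain φ D) :
    -- the mean Berwald term and the χ-curvature
    (∀ x y : Coord n, Over D x y →
      ∀ z ρ α s : ℝ, z = zOf y → ρ = spNorm x → α = spNorm y → s = spDot x y →
      ∀ u w : ℝ, u = U φ z ρ → w = W φ z ρ →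
      ∀ Ψz Ψzz Ψzρ : ℝ, Ψz = dz (Psi n φ) z ρ → Ψzz = dz (dz (Psi n φ)) z ρ →
        Ψzρ = dr (dz (Psi n φ)) z ρ →
      meanBerwald (spray (metricL φ)) x y = Psi n φ z ρ * s ∧
      chiCurv (spray (metricL φ)) 0 x y =
        (1 / (2 * ρ) * Ψzρ - u * Ψzz - w * Ψz) * (s ^ 2 / α)
          + 1 / 2 * (2 * ρ ^ 2 * w + 1) * Ψz * α ∧
      ∀ i : Fin n,
        chiCurv (spray (metricL φ)) i.succ x y =
          (z * u * Ψzz - z / (2 * ρ) * Ψzρ + (u + 2 * z * w) * Ψz) * (s ^ 2 / α ^ 2) * y i.succ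
            - z / 2 * (2 * ρ ^ 2 * w + 1) * Ψz * y i.succ
            - (u + z * w) * Ψz * s * x i.succ) ∧
    -- if `Ψ_z = 0` then the χ-curvature vanishes
    ((∀ p ∈ D, dz (Psi n φ) p.1 p.2 = 0) →
      ∀ x y : Coord n, Over D x y → ∀ A : Fin (n + 1),
        chiCurv (spray (metricL φ)) A x y = 0) ∧
    -- the constructed solutions satisfy `Ψ_z = 0` and are strongly Ricci-flat
    (IsConstructed n (Prod.snd '' D) φ →
      (∀ p ∈ D, dz (Psi n φ) p.1 p.2 = 0) ∧
      ∀ x y : Coord n, Over D x y →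
        ricci (spray (metricL φ)) x y = 0 ∧
        ∀ A B : Fin (n + 1),
          ricciAZ (spray (metricL φ)) A B x y = 0 ∧
          ricciLS (spray (metricL φ)) A B x y = 0) := by
  refine ⟨?_, fun hΨ x y h A => hD.chiCurv_eq_zero hΨ h A, fun h => h.stronglyRicciFlat hD⟩
  rintro x y h z ρ α s rfl rfl rfl rfl u w rfl rfl Ψz Ψzz Ψzρ rfl rfl rfl
  exact ⟨hD.meanBerwald_eq x y h, hD.chiCurv_zero h, fun i => hD.chiCurv_succ h i⟩
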